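/- **Model.** An affine congestion game $\Gamma$ has players $1,\dots,n$, a finite set $E$ of resources, strategy sets $\mathcal S_i\subseteq 2^E$ and cost functions $c_e(x)=a_ex+b_e$ with $a_e,b_e\ge 0$; it is *linear* if all $b_e=0$ and *symmetric* if all $\mathcal S_i$ are equal. For a profile $s=(s_1,\dots,s_n)\in\prod_i\mathcal S_i$ let $x_e(s)=|\{i: e\in s_i\}|$. For $\rho,\sigma\ge 0$ put $$C_i^\rho(s)=\sum_{e\in s_i}\bigl(a_e[1+\rho(x_e(s)-1)]+b_e\bigr),\qquad C^\sigma(s)=\sum_i C_i^\sigma(s).$$ Let $NE(\rho)$ be the set of pure Nash equilibria for the player costs $C_i^\rho$, and $$\mathrm{PoA}(\Gamma,\rho,\sigma)=\frac{\max_{s\in NE(\rho)}C^\sigma(s)}{\min_{s^*}C^\sigma(s^*)},\qquad \mathrm{PoS}(\Gamma,\rho,\sigma)=\frac{\min_{s\in NE(\rho)}C^\sigma(s)}{\min_{s^*}C^\sigma(s^*)},$$ where $s^*$ ranges over all strategy profiles, as elements of $[0,\infty]$ ($c/0=\infty$ for $c>0$, and $0/0=0$). For a collection $\mathcal H$ of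 games, $\mathrm{PoA}(\mathcal H,\rho,\sigma)$ and $\mathrm{PoS}(\mathcal H,\rho,\sigma)$ are the suprema over $\Gamma\in\mathcal H$. $\Gamma$ is a (directed or undirected) *network* congestion game if its resources are the edges of a finite (directed or undirected) multigraph and each $\mathcal S_i$ is the set of all simple $(s_i,t_i)$-paths for some vertices $s_i,t_i$. A graph with two terminals is *extension-parallel* if it is a single edge between the terminals, or a single edge composed in series with an extension-parallel graph, or the parallel composition of two extension-parallel graphs. A symmetric game *on* such a graph has as common strategy set all simple paths between the two terminals. **Theorem.** For $\rho\ge 0$ let $$B(\rho)=\begin{cases}\dfrac{4}{\rho(4-\rho)} & 0\le\rho\le 1\quad(B(0)=\infty),\\[2mm] \dfrac{4}{2+\rho} & 1\le\rho\le 2,\\[2mm] \dfrac{2+\rho}{4} & \rho\ge 2.\end{cases}$$ Then, both for directed and for undirected networks: 1. every linear symmetric network congestion game $\Gamma$ satisfies $\mathrm{PoS}(\Gamma,\rho,1)\le B(\rho)$; 2. every linear symmetric congestion game $\Gamma$ on an extension-parallel graph satisfies $\mathrm{PoA}(\Gamma,\rho,1)\le B(\rho)$; 3. the bounds are tight: $\mathrm{PoS}(\mathcal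 H,\rho,1)=B(\rho)$ for the collection $\mathcal H$ of all linear symmetric network congestion games, and $\mathrm{PoA}(\mathcal H',\rho,1)=B(\rho)$ for the collection $\mathcal H'$ of all linear symmetric congestion games on extension-parallel graphs. -/

import Mathlib

open scoped ENNReal

universe u

/-- An affine congestion game with player set `Fin n`, finite resource set `Res`, strategy sets
`strat i ⊆ 2^Res` and cost functions `c_e(x) = a e * x + b e` with nonnegative coefficients. -/
structure AffineCongestionGame where
  /-- number of players -/
  n : ℕ
  /-- resources -/
  Res : Type u
  [fintypeRes : Fintype Res]
  [decEqRes : DecidableEq Res]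
  /-- strategy sets -/
  strat : Fin n → Set (Finset Res)
  /-- slopes of the cost functions -/
  a : Res → ℝ
  /-- constant terms of the cost functions -/
  b : Res → ℝ
  a_nonneg : ∀ e, 0 ≤ a e
  b_nonneg : ∀ e, 0 ≤ b e

namespace AffineCongestionGame

attribute [instance] AffineCongestionGame.fintypeRes AffineCongestionGame.decEqRes

/-- Linear games: all constant terms vanish. -/
def IsLinear (Γ : AffineCongestionGame.{u}) : Prop := ∀ e, Γ.b e = 0

/-- Symmetric games: all players have the same strategy set. -/
def IsSymmetric (Γ : AffineCongestionGame.{u}) : Prop := ∀ i j, Γ.strat i = Γ.strat j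

/-- Strategy profiles. -/
abbrev Profile (Γ : AffineCongestionGame.{u}) : Type u := ∀ i : Fin Γ.n, Γ.strat i

/-- The number `x_e(s)` of players that use resource `e` in the profile `s`. -/
def load (Γ : AffineCongestionGame.{u}) (s : Γ.Profile) (e : Γ.Res) : ℕ :=
  (Finset.univ.filter fun i => e ∈ (s i : Finset Γ.Res)).card

/-- The perceived cost `C_i^ρ(s) = ∑_{e ∈ s_i} (a_e (1 + ρ (x_e - 1)) + b_e)`. -/
def playerCost (Γ : AffineCongestionGame.{u}) (ρ : ℝ) (s : Γ.Profile) (i : Fin Γ.n) : ℝ :=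
  ∑ e ∈ (s i : Finset Γ.Res), (Γ.a e * (1 + ρ * ((Γ.load s e : ℝ) - 1)) + Γ.b e)

/-- The social cost `C^σ(s) = ∑_i C_i^σ(s)`. -/
def socialCost (Γ : AffineCongestionGame.{u}) (σ : ℝ) (s : Γ.Profile) : ℝ :=
  ∑ i, Γ.playerCost σ s i

/-- Pure Nash equilibria with respect to the player costs `C_i^ρ`. -/
def IsNash (Γ : AffineCongestionGame.{u}) (ρ : ℝ) (s : Γ.Profile) : Prop :=
  ∀ (i : Fin Γ.n) (t : Γ.strat i),
    Γ.playerCost ρ s i ≤ Γ.playerCost ρ (Function.update s i t) i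

/-- The minimum social cost. -/
noncomputable def optCost (Γ : AffineCongestionGame.{u}) (σ : ℝ) : ℝ≥0∞ :=
  ⨅ s : Γ.Profile, ENNReal.ofReal (Γ.socialCost σ s)

/-- The price of anarchy. The quotient is taken in `[0, ∞]`, so that `c / 0 = ∞` for `c > 0`. -/
noncomputable def PoA (Γ : AffineCongestionGame.{u}) (ρ σ : ℝ) : ℝ≥0∞ :=
  (⨆ (s : Γ.Profile) (_ : Γ.IsNash ρ s), ENNReal.ofReal (Γ.socialCost σ s)) / Γ.optCost σ

/-- The price of stability. The quotient is taken in `[0, ∞]`, so that `c / 0 = ∞` for `c > 0`. -/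
noncomputable def PoS (Γ : AffineCongestionGame.{u}) (ρ σ : ℝ) : ℝ≥0∞ :=
  (⨅ (s : Γ.Profile) (_ : Γ.IsNash ρ s), ENNReal.ofReal (Γ.socialCost σ s)) / Γ.optCost σ

/-- The price of anarchy of a collection of games. -/
noncomputable def classPoA (H : Set AffineCongestionGame.{u}) (ρ σ : ℝ) : ℝ≥0∞ :=
  ⨆ Γ ∈ H, Γ.PoA ρ σ

/-- The price of stability of a collection of games. -/
noncomputable def classPoS (H : Set AffineCongestionGame.{u}) (ρ σ : ℝ) : ℝ≥0∞ :=
  ⨆ Γ ∈ H, Γ.PoS ρ σ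

end AffineCongestionGame

/-- Whether the edges of a graph may be traversed in one direction only or in both. -/
inductive EdgeKind where
  | directed
  | undirected

/-- A graph with vertices `V` and edges `E`; parallel edges are allowed. In the undirected reading
`src e` and `tgt e` are just the two end points of `e`. -/
structure EdgeGraph (V E : Type u) where
  src : E → V
  tgt : E → V

namespace EdgeGraph

variable {V E : Type u}

/-- The edge `e` can be traversed from `u` to `v`. -/
def Joins (G : EdgeGraph V E) : EdgeKind → E → V → V → Prop
  | .directed, e, u, v => G.src e = u ∧ G.tgt e = v
  | .undirected, e, u, v => (G.src e = u ∧ G.tgt e = v) ∨ (G.src e = v ∧ G.tgt e = u)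

/-- `G.IsWalk k u v vs es`: there is a walk from `u` to `v` with vertex sequence `vs` and edge
sequence `es`. -/
inductive IsWalk (G : EdgeGraph V E) (k : EdgeKind) : V → V → List V → List E → Prop
  | nil (v : V) : IsWalk G k v v [v] []
  | cons {u v w : V} {e : E} {vs : List V} {es : List E} (h : G.Joins k e u v)
      (p : IsWalk G k v w vs es) : IsWalk G k u w (u :: vs) (e :: es)

/-- The set of all simple `(s, t)`-paths, each given by its set of edges. -/
def paths (G : EdgeGraph V E) (k : EdgeKind) (s t : V) : Set (Finset E) :=
  {F | ∃ vs es, G.IsWalk k s t vs es ∧ vs.Nodup ∧ ∀ e, e ∈ F ↔ e ∈ es}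

/-- `G.IsExtPar k s t W F`: the subgraph of `G` with vertex set `W` and edge set `F` is
extension-parallel with terminals `s` and `t`. It is a single edge, or a single edge composed in
series (before or after) with an extension-parallel graph, or the parallel composition of two
extension-parallel graphs, which share their terminals and nothing else. -/
inductive IsExtPar (G : EdgeGraph V E) (k : EdgeKind) : V → V → Set V → Set E → Prop
  | single {s t : V} {e : E} (h : G.Joins k e s t) (hst : s ≠ t) : IsExtPar G k s t {s, t} {e}
  | edgeSeries {s m t : V} {e : E} {W : Set V} {F : Set E} (h : G.Joins k e s m) (hs : s ∉ W)
      (p : IsExtPar G k m t W F) : IsExtPar G k s t (insert s W) (insert e F)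
  | seriesEdge {s m t : V} {e : E} {W : Set V} {F : Set E} (h : G.Joins k e m t) (ht : t ∉ W)
      (p : IsExtPar G k s m W F) : IsExtPar G k s t (insert t W) (insert e F)
  | parallel {s t : V} {W₁ W₂ : Set V} {F₁ F₂ : Set E} (hW : W₁ ∩ W₂ = {s, t})
      (hF : Disjoint F₁ F₂) (p : IsExtPar G k s t W₁ F₁) (q : IsExtPar G k s t W₂ F₂) :
      IsExtPar G k s t (W₁ ∪ W₂) (F₁ ∪ F₂)

end EdgeGraph

namespace AffineCongestionGame

/-- Network congestion games: the resources are the edges of a finite graph, and the strategies of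
player `i` are all simple `(s i, t i)`-paths. -/
def IsNetwork (Γ : AffineCongestionGame.{u}) (k : EdgeKind) : Prop :=
  ∃ (V : Type u) (_ : Finite V) (G : EdgeGraph V Γ.Res) (s t : Fin Γ.n → V),
    ∀ i, Γ.strat i = G.paths k (s i) (t i)

/-- Symmetric network congestion games on an extension-parallel graph: the strategies of every
player are all simple paths between the two terminals. -/
def IsOnExtPar (Γ : AffineCongestionGame.{u}) (k : EdgeKind) : Prop :=
  ∃ (V : Type u) (_ : Finite V) (G : EdgeGraph V Γ.Res) (s t : V),
    G.IsExtPar k s t Set.univ Set.univ ∧ ∀ i, Γ.strat i = G.paths k s t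

end AffineCongestionGame

/-- The bound `4 / (ρ (4 - ρ))` on `[0, 1]` (which is `∞` at `ρ = 0`), `4 / (2 + ρ)` on `[1, 2]`
and `(2 + ρ) / 4` on `[2, ∞)`. -/
noncomputable def perceptionBound (ρ : ℝ) : ℝ≥0∞ :=
  if ρ ≤ 1 then ENNReal.ofReal 4 / ENNReal.ofReal (ρ * (4 - ρ))
  else if ρ ≤ 2 then ENNReal.ofReal (4 / (2 + ρ))
  else ENNReal.ofReal ((2 + ρ) / 4)

/-!
Bounds on the price of stability and the price of anarchy of linear symmetric network congestion
games with player costs `C_i^ρ`, and parallel links that attain them in the limit.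

The upper bounds rest on a variational inequality. Moving the load of a resource of slope one from
`x` towards `y` changes the potential to first order by `deviationCost ρ x y`, which is
`(y - x) (1 + ρ x)` for `y ≥ x` and `-(x - y) (1 + ρ (x - 1))` for `y < x`. If the sum over all
resources of `a_e` times this quantity is nonnegative for the loads `x` of an equilibrium and the
loads `y` of any other profile, then the pointwise inequality
`x ^ 2 + c * deviationCost ρ x y ≤ β * y ^ 2` between integers (`exists_smoothness`), with `β` the
claimed bound, gives `C(x) ≤ β C(y)`, because the social cost is `∑ a_e x_e ^ 2`.

For a general symmetric network, profiles of simple paths correspond to integer flows: every profile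
carries a flow that it dominates, and every flow dominates the loads of a profile. A flow `f` of
minimum potential decomposes into the paths of a profile of minimum potential, which is an
equilibrium. The variational inequality for `f` holds since the difference `g - f` to another flow is
a conformal sum of cycles with entries in `{-1, 0, 1}`; adding one such cycle to `f` gives a flow, so
that it cannot decrease the potential. On undirected graphs the flows are signed, and their
orientation is taken care of by reversing edges.

On an extension-parallel graph the variational inequality holds for every equilibrium. This is proved
by induction on the composition of the graph (`ExtParFamily.le_sum_stepCost`), together with a
bound for components that have different numbers of users in the two profiles.

Tightness is witnessed by `n` players on parallel links of which one has slope `1` and all others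
have the same slope `A` (`linkGame`). The slope is chosen slightly off a critical value, so that
every equilibrium is expensive, which bounds the price of stability from below.
-/

/-! ### Walks and integer flows -/

namespace EdgeGraph

variable {V E : Type u} {G : EdgeGraph V E} {k : EdgeKind}

theorem IsWalk.start_mem {s t : V} {vs : List V} {es : List E} (h : G.IsWalk k s t vs es) :
    s ∈ vs := by
  cases h <;> simp

theorem IsWalk.end_mem {s t : V} {vs : List V} {es : List E} (h : G.IsWalk k s t vs es) :
    t ∈ vs := by
  induction h with
  | nil v => simp
  | cons h p ih => exact List.mem_cons_of_mem _ ih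

theorem IsWalk.ends_mem {s t : V} {vs : List V} {es : List E} (h : G.IsWalk k s t vs es) :
    ∀ e ∈ es, G.src e ∈ vs ∧ G.tgt e ∈ vs := by
  induction h with
  | nil v => simp
  | @cons u v w e vs es h p ih =>
    have hv := p.start_mem
    intro f hf
    rcases List.mem_cons.1 hf with rfl | hf
    · cases k
      · obtain ⟨rfl, rfl⟩ := h
        exact ⟨by simp, by simp [hv]⟩
      · rcases h with ⟨rfl, rfl⟩ | ⟨rfl, rfl⟩
        · exact ⟨by simp, by simp [hv]⟩
        · exact ⟨by simp [hv], by simp⟩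
    · exact ⟨List.mem_cons_of_mem _ (ih f hf).1, List.mem_cons_of_mem _ (ih f hf).2⟩

/-- A simple walk contains a simple walk from each of its vertices to its end. -/
theorem IsWalk.exists_suffix {s t : V} {vs : List V} {es : List E} (h : G.IsWalk k s t vs es)
    (hn : vs.Nodup) {u : V} (hu : u ∈ vs) :
    ∃ vs' es', G.IsWalk k u t vs' es' ∧ vs'.Nodup ∧ es' ⊆ es := by
  induction h with
  | nil v =>
    obtain rfl : u = v := by simpa using hu
    exact ⟨_, _, .nil u, by simp, by simp⟩
  | @cons a v w e vs es h p ih =>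
    by_cases hua : u = a
    · subst hua
      exact ⟨_, _, .cons h p, hn, fun _ h => h⟩
    · obtain ⟨vs', es', h1, h2, h3⟩ :=
        ih (List.nodup_cons.1 hn).2 ((List.mem_cons.1 hu).resolve_left hua)
      exact ⟨vs', es', h1, h2, fun _ hx => List.mem_cons_of_mem _ (h3 hx)⟩

/-- The vertex vector `1_s - 1_t`. -/
noncomputable def demand (s t : V) : V → ℤ :=
  open Classical in Pi.single s 1 - Pi.single t 1

theorem demand_self (s : V) : demand s s = 0 := by simp [demand]

theorem demand_add (s m t : V) : demand s m + demand m t = demand s t := by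
  simp [demand]

theorem neg_demand (s t : V) : -demand s t = demand t s := by simp [demand]

open Classical in
theorem sum_demand (R : Finset V) (s t : V) :
    ∑ v ∈ R, demand s t v = (if s ∈ R then 1 else 0) - (if t ∈ R then 1 else 0) := by
  simp [demand, Finset.sum_sub_distrib, Finset.sum_pi_single']

variable [Fintype E]

/-- The net outflow at every vertex of a signed edge vector; a negative entry stands for flow
against the orientation of the edge. -/
noncomputable def netOut (G : EdgeGraph V E) (z : E → ℤ) : V → ℤ :=
  ∑ e, z e • demand (G.src e) (G.tgt e)

theorem netOut_zero : G.netOut 0 = 0 := by simp [netOut]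

theorem netOut_add (z w : E → ℤ) : G.netOut (z + w) = G.netOut z + G.netOut w := by
  simp [netOut, add_smul, Finset.sum_add_distrib]

theorem netOut_sub (z w : E → ℤ) : G.netOut (z - w) = G.netOut z - G.netOut w := by
  simp [netOut, sub_smul, Finset.sum_sub_distrib]

open Classical in
theorem netOut_single (e : E) (x : ℤ) :
    G.netOut (Pi.single e x) = x • demand (G.src e) (G.tgt e) := by
  rw [netOut, Finset.sum_eq_single e] <;> simp +contextual

/-- Integer flows of value `n` from `s` to `t`. On a directed graph they are nonnegative; on an
undirected graph the sign of an entry is the direction in which the edge is used. -/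
structure IsFlow (G : EdgeGraph V E) (k : EdgeKind) (s t : V) (n : ℕ) (z : E → ℤ) : Prop where
  nonneg : k = .directed → ∀ e, 0 ≤ z e
  netOut_eq : G.netOut z = n • demand s t

/-- A simple walk carries a unit flow. No edge of it leaves the last vertex. -/
theorem IsWalk.exists_flow {s t : V} {vs : List V} {es : List E} (h : G.IsWalk k s t vs es)
    (hn : vs.Nodup) :
    ∃ c : E → ℤ, G.IsFlow k s t 1 c ∧ (∀ e ∈ es, |c e| = 1) ∧ (∀ e ∉ es, c e = 0) ∧
      ∀ e, (0 < c e → G.src e ≠ t) ∧ (c e < 0 → G.tgt e ≠ t) := by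
  classical
  induction h with
  | nil v => exact ⟨0, ⟨by simp, by simp [netOut_zero, demand_self]⟩, by simp, by simp, by simp⟩
  | @cons u v w e vs es h p ih =>
    obtain ⟨hu, hn⟩ := List.nodup_cons.1 hn
    obtain ⟨c, ⟨h0, h1⟩, h2, h3, h4⟩ := ih hn
    have huw : u ≠ w := fun h' => hu (h' ▸ p.end_mem)
    have hor : ∃ ε : ℤ, (ε = 1 ∧ G.src e = u ∧ G.tgt e = v) ∨
        (ε = -1 ∧ k ≠ .directed ∧ G.src e = v ∧ G.tgt e = u) := by
      cases k
      · exact ⟨1, Or.inl ⟨rfl, h⟩⟩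
      · rcases h with h | h
        · exact ⟨1, Or.inl ⟨rfl, h⟩⟩
        · exact ⟨-1, Or.inr ⟨rfl, by simp, h⟩⟩
    obtain ⟨ε, hε⟩ := hor
    have he : e ∉ es := fun h' => by
      have := p.ends_mem e h'
      rcases hε with ⟨-, h5, h6⟩ | ⟨-, -, h5, h6⟩
      · exact hu (h5 ▸ this.1)
      · exact hu (h6 ▸ this.2)
    have hce := h3 e he
    refine ⟨c + Pi.single e ε, ⟨fun hk f => ?_, ?_⟩, fun f hf => ?_, fun f hf => ?_, fun f => ?_⟩
    · rcases hε with ⟨rfl, -⟩ | ⟨-, h5, -⟩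
      · have := h0 hk f
        by_cases hf : f = e
        · subst hf; simp [hce]
        · simpa [Pi.single_apply, hf] using this
      · exact absurd hk h5
    · rw [netOut_add, netOut_single, h1, one_smul, one_smul, ← demand_add u v w, add_comm]
      congr 1
      rcases hε with ⟨rfl, h5, h6⟩ | ⟨rfl, -, h5, h6⟩
      · rw [h5, h6, one_smul]
      · rw [h5, h6, neg_smul, one_smul, neg_demand]
    · by_cases hfe : f = e
      · subst hfe
        rcases hε with ⟨rfl, -⟩ | ⟨rfl, -⟩ <;> simp [hce]
      · simpa [Pi.single_apply, hfe] using h2 f ((List.mem_cons.1 hf).resolve_left hfe)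
    · rw [List.mem_cons, not_or] at hf
      simpa [Pi.single_apply, hf.1] using h3 f hf.2
    · by_cases hfe : f = e
      · subst hfe
        rcases hε with ⟨rfl, h5, h6⟩ | ⟨rfl, -, h5, h6⟩
        · simp [hce, h5, huw]
        · simp [hce, h6, huw]
      · simpa [Pi.single_apply, hfe] using h4 f

/-- In a nonnegative flow of positive value, the sink is reachable from the source through edges
that carry flow: no flow could leave the set of reachable vertices. -/
theorem exists_walk_of_nonneg [Finite V] {s t : V} {n : ℕ} {z : E → ℤ} (hz : ∀ e, 0 ≤ z e)
    (hn : 0 < n) (h : G.netOut z = n • demand s t) :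
    ∃ vs es, G.IsWalk .directed s t vs es ∧ vs.Nodup ∧ ∀ e ∈ es, 0 < z e := by
  classical
  have := Fintype.ofFinite V
  let r : V → V → Prop := fun u v => ∃ e, G.src e = u ∧ G.tgt e = v ∧ 0 < z e
  have hreach : Relation.ReflTransGen r s t := by
    by_contra hcon
    let R : Finset V := Finset.univ.filter fun v => Relation.ReflTransGen r s v
    have hsum : ∑ v ∈ R, G.netOut z v = n := by
      rw [h]
      simp only [Pi.smul_apply, ← Finset.smul_sum, sum_demand]
      simp [R, hcon, Relation.ReflTransGen.refl]
    have hle : ∑ v ∈ R, G.netOut z v ≤ 0 := by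
      simp only [netOut, Finset.sum_apply, Pi.smul_apply]
      rw [Finset.sum_comm]
      refine Finset.sum_nonpos fun e _ => ?_
      rw [← Finset.smul_sum, sum_demand]
      rcases (hz e).eq_or_lt with h0 | h0
      · simp [← h0]
      · by_cases hs : G.src e ∈ R
        · have ht : G.tgt e ∈ R := by
            simp only [R, Finset.mem_filter, Finset.mem_univ, true_and] at hs ⊢
            exact hs.tail ⟨e, rfl, rfl, h0⟩
          simp [hs, ht]
        · simp only [hs, if_false, smul_eq_mul]
          split_ifs <;> simp [h0.le]
    omega
  clear h
  induction hreach using Relation.ReflTransGen.head_induction_on with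
  | refl => exact ⟨_, _, .nil t, by simp, by simp⟩
  | head hr _ ih =>
    rename_i a c _
    obtain ⟨vs, es, h1, h2, h3⟩ := ih
    obtain ⟨e, he1, he2, he3⟩ := hr
    by_cases ha : a ∈ vs
    · obtain ⟨vs', es', h4, h5, h6⟩ := h1.exists_suffix h2 ha
      exact ⟨vs', es', h4, h5, fun e he => h3 e (h6 he)⟩
    · exact ⟨_, _, .cons ⟨he1, he2⟩ h1, List.nodup_cons.2 ⟨ha, h2⟩, by
        simpa [he3] using h3⟩

end EdgeGraph

/-! ### Conformal decomposition of integer flows -/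

namespace EdgeGraph

variable {V E : Type u} {G : EdgeGraph V E} {k : EdgeKind}

/-- The graph in which the edges with a negative entry are reversed, so that the flow becomes
nonnegative. -/
def reorient (G : EdgeGraph V E) (z : E → ℤ) : EdgeGraph V E where
  src e := if z e < 0 then G.tgt e else G.src e
  tgt e := if z e < 0 then G.src e else G.tgt e

theorem IsWalk.of_reorient {z : E → ℤ} {s t : V} {vs : List V} {es : List E}
    (h : (G.reorient z).IsWalk .directed s t vs es) (hk : k = .directed → ∀ e, 0 ≤ z e) :
    G.IsWalk k s t vs es := by
  induction h with
  | nil v => exact .nil v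
  | @cons u v w e vs es h p ih =>
    refine .cons ?_ ih
    cases k
    · have := (hk rfl e).not_gt
      simpa [Joins, reorient, this] using h
    · by_cases h0 : z e < 0
      · exact Or.inr (by simpa [Joins, reorient, h0, and_comm] using h)
      · exact Or.inl (by simpa [Joins, reorient, h0] using h)

variable [Fintype E]

theorem netOut_reorient (z w : E → ℤ) :
    (G.reorient z).netOut w = G.netOut fun e => if z e < 0 then -w e else w e := by
  refine Finset.sum_congr rfl fun e _ => ?_
  by_cases h : z e < 0
  · simp only [reorient, h, if_true, neg_smul]
    rw [← smul_neg, neg_demand]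
  · simp [reorient, h]

/-- A flow of positive value contains a simple path that uses every edge in the direction of the
flow. No edge of the path leaves the sink, so that the path can be closed up to a cycle. -/
theorem exists_conformal_path [Finite V] {s t : V} {n : ℕ} {z : E → ℤ}
    (h : G.IsFlow k s t n z) (hn : 0 < n) :
    ∃ F ∈ G.paths k s t, ∃ c : E → ℤ, G.netOut c = demand s t ∧
      (∀ e ∈ F, z e ≠ 0 ∧ c e = (z e).sign) ∧ (∀ e ∉ F, c e = 0) ∧
      ∀ e, (0 < c e → G.src e ≠ t) ∧ (c e < 0 → G.tgt e ≠ t) := by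
  classical
  have hz : (G.reorient z).netOut (fun e => |z e|) = n • demand s t := by
    rw [netOut_reorient, ← h.netOut_eq]
    congr 1
    funext e
    split_ifs with h0
    · simp [abs_of_neg h0]
    · simp [abs_of_nonneg (not_lt.1 h0)]
  obtain ⟨vs, es, hw, hvs, hes⟩ := exists_walk_of_nonneg (fun e => abs_nonneg _) hn hz
  obtain ⟨c, hc, h1, h2, h3⟩ := hw.exists_flow hvs
  have hc1 : ∀ e ∈ es, c e = 1 := fun e he => by
    simpa [abs_of_nonneg (hc.nonneg rfl e)] using h1 e he
  refine ⟨es.toFinset, ⟨vs, es, hw.of_reorient h.nonneg, hvs, by simp⟩,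
    fun e => if z e < 0 then -c e else c e, ?_, fun e he => ?_, fun e he => ?_, fun e => ?_⟩
  · rw [← netOut_reorient, hc.netOut_eq, one_smul]
  · rw [List.mem_toFinset] at he
    have hze : z e ≠ 0 := abs_pos.1 (hes e he)
    refine ⟨hze, ?_⟩
    simp only [hc1 e he]
    split_ifs with h0
    · exact (Int.sign_eq_neg_one_of_neg h0).symm
    · exact (Int.sign_eq_one_of_pos (by omega)).symm
  · rw [List.mem_toFinset] at he
    simp [h2 e he]
  · have h4 := hc.nonneg rfl e
    have h5 := (h3 e).1
    by_cases h0 : z e < 0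
    · simp only [h0, if_true]
      refine ⟨fun h6 => by omega, fun h6 => ?_⟩
      simpa [reorient, h0] using h5 (by omega)
    · simp only [h0, if_false]
      refine ⟨fun h6 => ?_, fun h6 => by omega⟩
      simpa [reorient, h0] using h5 h6

/-- Removing one unit of flow from an edge of a circulation leaves a flow from the head of the edge
to its tail; a path of this flow closes up to a cycle. -/
theorem exists_conformal_cycle [Finite V] {z : E → ℤ} (h : G.netOut z = 0) (hz : z ≠ 0) :
    ∃ c : E → ℤ, c ≠ 0 ∧ G.netOut c = 0 ∧ ∀ e, c e = 0 ∨ z e ≠ 0 ∧ c e = (z e).sign := by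
  classical
  obtain ⟨e, he⟩ := Function.ne_iff.1 hz
  rw [Pi.zero_apply] at he
  obtain ⟨u, v, huv, htail⟩ : ∃ u v, (z e).sign • demand (G.src e) (G.tgt e) = demand u v ∧
      ((z e).sign = 1 ∧ 0 < z e ∧ G.src e = u ∨ (z e).sign = -1 ∧ z e < 0 ∧ G.tgt e = u) := by
    rcases lt_or_gt_of_ne he with h0 | h0
    · have := Int.sign_eq_neg_one_of_neg h0
      exact ⟨G.tgt e, G.src e, by rw [this, neg_smul, one_smul, neg_demand],
        Or.inr ⟨this, h0, rfl⟩⟩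
    · have := Int.sign_eq_one_of_pos h0
      exact ⟨G.src e, G.tgt e, by rw [this, one_smul], Or.inl ⟨this, h0, rfl⟩⟩
  have hflow : G.IsFlow .undirected v u 1 (z - Pi.single e (z e).sign) :=
    ⟨by simp, by rw [netOut_sub, h, netOut_single, huv, zero_sub, neg_demand, one_smul]⟩
  obtain ⟨F, -, c, h1, h2, h3, h4⟩ := exists_conformal_path hflow one_pos
  have hc : ∀ f, c f = 0 ∨ (z - Pi.single e (z e).sign : E → ℤ) f ≠ 0 ∧
      c f = ((z - Pi.single e (z e).sign : E → ℤ) f).sign := fun f => by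
    by_cases hf : f ∈ F
    · exact Or.inr (h2 f hf)
    · exact Or.inl (h3 f hf)
  -- The path ends at the tail of `e`, so it does not use `e`.
  have hce : c e = 0 := by
    rcases hc e with h0 | ⟨h5, h6⟩
    · exact h0
    · simp only [Pi.sub_apply, Pi.single_eq_same] at h5 h6
      rcases htail with ⟨h7, h8, h9⟩ | ⟨h7, h8, h9⟩
      · rw [h7] at h5 h6
        rw [Int.sign_eq_one_of_pos (by omega)] at h6
        exact absurd h9 ((h4 e).1 (by omega))
      · rw [h7] at h5 h6
        rw [Int.sign_eq_neg_one_of_neg (by omega)] at h6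
        exact absurd h9 ((h4 e).2 (by omega))
  refine ⟨c + Pi.single e (z e).sign, fun h0 => ?_, ?_, fun f => ?_⟩
  · have := congrFun h0 e
    simp [hce, he] at this
  · rw [netOut_add, h1, netOut_single, huv, demand_add, demand_self]
  · by_cases hf : f = e
    · subst hf
      exact Or.inr ⟨he, by simp [hce]⟩
    · simpa [Pi.single_apply, hf] using hc f

/-- The first-order cost of changing a flow on one edge by `x`, if an increase costs `p` per unit and
a decrease costs `q` per unit. -/
noncomputable def stepCost (p q : ℝ) (x : ℤ) : ℝ := if 0 ≤ x then x * p else -x * q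

/-- A circulation is a conformal sum of cycles, so that a cost which is linear on each orthant is
nonnegative on it once it is so on these cycles. -/
theorem stepCost_nonneg_of_cycles [Finite V] (p q : E → ℝ) (z : E → ℤ) (h : G.netOut z = 0)
    (hc : ∀ c : E → ℤ, G.netOut c = 0 → (∀ e, c e = 0 ∨ z e ≠ 0 ∧ c e = (z e).sign) →
      0 ≤ ∑ e, stepCost (p e) (q e) (c e)) :
    0 ≤ ∑ e, stepCost (p e) (q e) (z e) := by
  induction hm : ∑ e, (z e).natAbs using Nat.strong_induction_on generalizing z with
  | _ m ih =>
    by_cases hz : z = 0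
    · simp [hz, stepCost]
    obtain ⟨c, hc0, hc1, hc2⟩ := exists_conformal_cycle h hz
    have hsign : ∀ e, c e = 0 ∨ (c e = 1 ∧ 0 < z e) ∨ (c e = -1 ∧ z e < 0) := fun e => by
      rcases hc2 e with h0 | ⟨h0, h1⟩
      · exact Or.inl h0
      · rcases lt_or_gt_of_ne h0 with h2 | h2
        · exact Or.inr (Or.inr ⟨by rw [h1, Int.sign_eq_neg_one_of_neg h2], h2⟩)
        · exact Or.inr (Or.inl ⟨by rw [h1, Int.sign_eq_one_of_pos h2], h2⟩)
    have hadd : ∑ e, stepCost (p e) (q e) (z e) =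
        ∑ e, stepCost (p e) (q e) (c e) + ∑ e, stepCost (p e) (q e) ((z - c) e) := by
      rw [← Finset.sum_add_distrib]
      refine Finset.sum_congr rfl fun e _ => ?_
      rw [Pi.sub_apply]
      rcases hsign e with h0 | ⟨h0, h1⟩ | ⟨h0, h1⟩
      · simp [h0, stepCost]
      · rw [h0, stepCost, stepCost, stepCost, if_pos h1.le, if_pos (by norm_num),
          if_pos (by omega)]
        push_cast; ring
      · rw [h0, stepCost, stepCost, stepCost, if_neg h1.not_ge, if_neg (by norm_num)]
        split_ifs with h2
        · have : z e = -1 := by omega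
          rw [this]; norm_num
        · push_cast; ring
    rw [hadd]
    refine add_nonneg (hc c hc1 hc2) (ih _ ?_ _ (by rw [netOut_sub, h, hc1, sub_zero]) ?_ rfl)
    · rw [← hm]
      obtain ⟨e, he⟩ := Function.ne_iff.1 hc0
      rw [Pi.zero_apply] at he
      refine Finset.sum_lt_sum (fun f _ => ?_) ⟨e, Finset.mem_univ _, ?_⟩
      · rw [Pi.sub_apply]; have := hsign f; omega
      · rw [Pi.sub_apply]; have := hsign e; omega
    · refine fun c' h1 h2 => hc c' h1 fun e => (h2 e).imp id fun ⟨h3, h4⟩ => ?_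
      rw [Pi.sub_apply] at h3 h4
      have := hsign e
      rcases lt_or_gt_of_ne h3 with h5 | h5
      · have h6 : z e < 0 := by omega
        exact ⟨h6.ne, by rw [h4, Int.sign_eq_neg_one_of_neg h5, Int.sign_eq_neg_one_of_neg h6]⟩
      · have h6 : 0 < z e := by omega
        exact ⟨h6.ne', by rw [h4, Int.sign_eq_one_of_pos h5, Int.sign_eq_one_of_pos h6]⟩

/-- An integer flow dominates the loads of a profile of paths; the cycles in it are dropped. -/
theorem IsFlow.exists_paths [Finite V] [DecidableEq E] {s t : V} {n : ℕ} {z : E → ℤ}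
    (h : G.IsFlow k s t n z) :
    ∃ P : Fin n → Finset E, (∀ i, P i ∈ G.paths k s t) ∧
      ∀ e, ((Finset.univ.filter fun i => e ∈ P i).card : ℤ) ≤ |z e| := by
  induction n generalizing z with
  | zero => exact ⟨fun i => i.elim0, fun i => i.elim0, fun e => by simp⟩
  | succ n ih =>
    obtain ⟨F, hF, c, h1, h2, h3, -⟩ := exists_conformal_path h n.succ_pos
    have hrest : G.IsFlow k s t n (z - c) := by
      refine ⟨fun hk e => ?_, ?_⟩
      · rw [Pi.sub_apply]
        have h0 := h.nonneg hk e
        by_cases he : e ∈ F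
        · obtain ⟨h4, h5⟩ := h2 e he
          rw [h5, Int.sign_eq_one_of_pos (by omega)]
          omega
        · rw [h3 e he]; omega
      · rw [netOut_sub, h.netOut_eq, h1, succ_nsmul, add_sub_cancel_right]
    obtain ⟨P, hP, hle⟩ := ih hrest
    refine ⟨Fin.cons F P, fun i => ?_, fun e => ?_⟩
    · refine Fin.cases ?_ (fun i => ?_) i
      · exact hF
      · exact hP i
    · have := hle e
      rw [Finset.card_filter] at this ⊢
      rw [Fin.sum_univ_succ]
      simp only [Fin.cons_zero, Fin.cons_succ, Pi.sub_apply] at this ⊢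
      by_cases he : e ∈ F
      · obtain ⟨h4, h5⟩ := h2 e he
        rw [if_pos he]
        rcases lt_or_gt_of_ne h4 with h6 | h6
        · rw [h5, Int.sign_eq_neg_one_of_neg h6, abs_of_nonpos (by omega)] at this
          rw [abs_of_neg h6]; push_cast at this ⊢; linarith
        · rw [h5, Int.sign_eq_one_of_pos h6, abs_of_nonneg (by omega)] at this
          rw [abs_of_pos h6]; push_cast at this ⊢; linarith
      · rw [h3 e he, sub_zero] at this
        simpa [he] using this

theorem netOut_sum {ι : Type*} (I : Finset ι) (c : ι → E → ℤ) :
    G.netOut (∑ i ∈ I, c i) = ∑ i ∈ I, G.netOut (c i) := by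
  classical
  induction I using Finset.induction_on with
  | empty => simp [netOut_zero]
  | insert i I hi ih => rw [Finset.sum_insert hi, Finset.sum_insert hi, netOut_add, ih]

theorem exists_flow_of_paths [DecidableEq E] {s t : V} {n : ℕ} (P : Fin n → Finset E)
    (hP : ∀ i, P i ∈ G.paths k s t) :
    ∃ z : E → ℤ, G.IsFlow k s t n z ∧
      ∀ e, |z e| ≤ ((Finset.univ.filter fun i => e ∈ P i).card : ℤ) := by
  have h : ∀ i, ∃ c : E → ℤ, G.IsFlow k s t 1 c ∧ ∀ e, |c e| ≤ if e ∈ P i then 1 else 0 := by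
    intro i
    obtain ⟨vs, es, hw, hvs, hes⟩ := hP i
    obtain ⟨c, hc, h1, h2, -⟩ := hw.exists_flow hvs
    refine ⟨c, hc, fun e => ?_⟩
    by_cases he : e ∈ es
    · rw [if_pos ((hes e).2 he), h1 e he]
    · rw [if_neg (mt (hes e).1 he), h2 e he, abs_zero]
  choose c hc hle using h
  refine ⟨∑ i, c i, ⟨fun hk e => ?_, ?_⟩, fun e => ?_⟩
  · rw [Finset.sum_apply]
    exact Finset.sum_nonneg fun i _ => (hc i).nonneg hk e
  · simp [netOut_sum, fun i => (hc i).netOut_eq]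
  · rw [Finset.card_filter, Finset.sum_apply]
    push_cast
    exact (Finset.abs_sum_le_sum_abs _ _).trans (Finset.sum_le_sum fun i _ => hle i e)

end EdgeGraph

/-! ### The smoothness inequality -/

/-- The first-order change of the potential on a resource of slope one when its load moves from `x`
towards `y`: each of the `y - x` new users pays for joining load `x`, or each of the `x - y` leaving
users saves the cost at load `x`. -/
noncomputable def deviationCost (ρ : ℝ) (x y : ℤ) : ℝ :=
  EdgeGraph.stepCost (1 + ρ * x) (-(1 + ρ * (x - 1))) (y - x)

theorem deviationCost_of_le {ρ : ℝ} {x y : ℤ} (h : x ≤ y) :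
    deviationCost ρ x y = (y - x) * (1 + ρ * x) := by
  rw [deviationCost, EdgeGraph.stepCost, if_pos (by omega)]; push_cast; ring

theorem deviationCost_of_lt {ρ : ℝ} {x y : ℤ} (h : y < x) :
    deviationCost ρ x y = -((x - y) * (1 + ρ * (x - 1))) := by
  rw [deviationCost, EdgeGraph.stepCost, if_neg (by omega)]; push_cast; ring

theorem Int.cast_le_sq (d : ℤ) : (d : ℝ) ≤ (d : ℝ) ^ 2 := by
  exact_mod_cast Int.le_self_sq d

/-- The multiplier of the deviation cost is the bound itself for `ρ ≤ 2`, and `1` for `ρ ≥ 2`. -/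
theorem exists_smoothness {ρ : ℝ} (hρ : 0 < ρ) :
    ∃ β c : ℝ, 0 ≤ β ∧ 0 ≤ c ∧ perceptionBound ρ = ENNReal.ofReal β ∧
      ∀ x y : ℤ, 0 ≤ x → 0 ≤ y → (x : ℝ) ^ 2 + c * deviationCost ρ x y ≤ β * (y : ℝ) ^ 2 := by
  have hscale : ∀ D : ℝ, 0 < D →
      (∀ x y : ℤ, 0 ≤ x → 0 ≤ y → D * (x : ℝ) ^ 2 + deviationCost ρ x y ≤ (y : ℝ) ^ 2) →
      ∀ x y : ℤ, 0 ≤ x → 0 ≤ y →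
        (x : ℝ) ^ 2 + 1 / D * deviationCost ρ x y ≤ 1 / D * (y : ℝ) ^ 2 := by
    intro D hD h x y hx hy
    have := mul_le_mul_of_nonneg_left (h x y hx hy) (one_div_pos.2 hD).le
    calc (x : ℝ) ^ 2 + 1 / D * deviationCost ρ x y
        = 1 / D * (D * (x : ℝ) ^ 2 + deviationCost ρ x y) := by field_simp
      _ ≤ _ := this
  have hup : ∀ D : ℝ, D ≤ 1 → ρ ≤ 2 → ∀ x y : ℤ, 0 ≤ x → x ≤ y →
      D * (x : ℝ) ^ 2 + deviationCost ρ x y ≤ (y : ℝ) ^ 2 := by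
    intro D hD h2 x y hx hxy
    rw [deviationCost_of_le hxy]
    have h1 := Int.cast_le_sq (y - x)
    have hx' : (0 : ℝ) ≤ x := by exact_mod_cast hx
    have hxy' : (0 : ℝ) ≤ y - x := by rw [sub_nonneg]; exact_mod_cast hxy
    push_cast at h1
    nlinarith [mul_nonneg (mul_nonneg hx' hxy') (sub_nonneg.2 h2),
      mul_nonneg (sub_nonneg.2 hD) (sq_nonneg (x : ℝ))]
  rcases le_or_gt ρ 1 with h1 | h1
  · have hD : 0 < ρ * (4 - ρ) / 4 := by
      have := mul_pos hρ (show 0 < 4 - ρ by linarith)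
      linarith
    refine ⟨1 / (ρ * (4 - ρ) / 4), 1 / (ρ * (4 - ρ) / 4), by positivity, by positivity, ?_,
      hscale _ hD fun x y hx hy => ?_⟩
    · rw [perceptionBound, if_pos h1, ← ENNReal.ofReal_div_of_pos (by linarith)]
      congr 1
      field_simp
    · rcases le_or_gt x y with h | h
      · exact hup _ (by nlinarith) (by linarith) x y hx h
      · rw [deviationCost_of_lt h]
        have : (0 : ℝ) ≤ x - y := by rw [sub_nonneg]; exact_mod_cast h.le
        nlinarith [sq_nonneg (y - ρ * x / 2 : ℝ), mul_nonneg (sub_nonneg.2 h1) this]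
  rcases le_or_gt ρ 2 with h2 | h2
  · have hD : 0 < (2 + ρ) / 4 := by linarith
    refine ⟨1 / ((2 + ρ) / 4), 1 / ((2 + ρ) / 4), by positivity, by positivity, ?_,
      hscale _ hD fun x y hx hy => ?_⟩
    · rw [perceptionBound, if_neg h1.not_ge, if_pos h2, one_div_div]
    · rcases le_or_gt x y with h | h
      · exact hup _ (by linarith) h2 x y hx h
      · rw [deviationCost_of_lt h]
        have h3 := Int.cast_le_sq (x - y)
        push_cast at h3
        nlinarith [mul_nonneg (sub_nonneg.2 h2) (sq_nonneg (y - x / 2 : ℝ)),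
          mul_nonneg (sub_nonneg.2 h1.le) (sub_nonneg.2 h3)]
  · refine ⟨(2 + ρ) / 4, 1, by positivity, zero_le_one, ?_, fun x y hx hy => ?_⟩
    · rw [perceptionBound, if_neg (by linarith), if_neg h2.not_ge]
    · rw [one_mul]
      have h3 := Int.cast_le_sq (x - y)
      have h4 := Int.cast_le_sq (y - x)
      push_cast at h3 h4
      rcases le_or_gt x y with h | h
      · rw [deviationCost_of_le h]
        nlinarith [mul_nonneg (sub_nonneg.2 h2.le) (sq_nonneg (2 * x - y : ℝ))]
      · rw [deviationCost_of_lt h]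
        have h5 : (0 : ℝ) ≤ x - y := by rw [sub_nonneg]; exact_mod_cast h.le
        have h6 : (0 : ℝ) ≤ x - 1 := by
          rw [sub_nonneg]; exact_mod_cast (show (1 : ℤ) ≤ x by omega)
        nlinarith [mul_nonneg (sub_nonneg.2 h2.le) (sq_nonneg (y : ℝ)),
          mul_nonneg (sub_nonneg.2 h2.le) (mul_nonneg h5 h6)]

theorem sum_sq_le_of_deviationCost {E : Type*} [Fintype E] {ρ β c : ℝ} (hc : 0 ≤ c)
    (hs : ∀ x y : ℤ, 0 ≤ x → 0 ≤ y → (x : ℝ) ^ 2 + c * deviationCost ρ x y ≤ β * (y : ℝ) ^ 2)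
    {a : E → ℝ} (ha : ∀ e, 0 ≤ a e) {x y : E → ℤ} (hx : ∀ e, 0 ≤ x e) (hy : ∀ e, 0 ≤ y e)
    (h : 0 ≤ ∑ e, a e * deviationCost ρ (x e) (y e)) :
    ∑ e, a e * (x e : ℝ) ^ 2 ≤ β * ∑ e, a e * (y e : ℝ) ^ 2 := by
  calc ∑ e, a e * (x e : ℝ) ^ 2
      ≤ ∑ e, a e * (x e : ℝ) ^ 2 + c * ∑ e, a e * deviationCost ρ (x e) (y e) :=
        le_add_of_nonneg_right (mul_nonneg hc h)
    _ = ∑ e, a e * ((x e : ℝ) ^ 2 + c * deviationCost ρ (x e) (y e)) := by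
        rw [Finset.mul_sum, ← Finset.sum_add_distrib]
        exact Finset.sum_congr rfl fun e _ => by ring
    _ ≤ ∑ e, a e * (β * (y e : ℝ) ^ 2) :=
        Finset.sum_le_sum fun e _ => mul_le_mul_of_nonneg_left (hs _ _ (hx e) (hy e)) (ha e)
    _ = β * ∑ e, a e * (y e : ℝ) ^ 2 := by
        rw [Finset.mul_sum]
        exact Finset.sum_congr rfl fun e _ => by ring

/-! ### The potential of integer flows -/

/-- The summand `∑_{j=1}^x (1 + ρ (j - 1))` of Rosenthal's potential for a resource of slope one
and load `x`. -/
noncomputable def resourcePotential (ρ : ℝ) (x : ℤ) : ℝ := x + ρ * (x * (x - 1) / 2)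

theorem resourcePotential_mono {ρ : ℝ} (hρ : 0 ≤ ρ) {m n : ℤ} (hm : 0 ≤ m) (h : m ≤ n) :
    resourcePotential ρ m ≤ resourcePotential ρ n := by
  rcases h.eq_or_lt with rfl | h
  · rfl
  have h1 : (0 : ℝ) ≤ n - m := by rw [sub_nonneg]; exact_mod_cast h.le
  have h2 : (0 : ℝ) ≤ n + m - 1 := by
    have : 0 ≤ n + m - 1 := by omega
    exact_mod_cast this
  unfold resourcePotential
  nlinarith [mul_nonneg hρ (mul_nonneg h1 h2)]

theorem EdgeGraph.stepCost_neg (p q : ℝ) (x : ℤ) : stepCost p q (-x) = stepCost q p x := by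
  rcases lt_trichotomy x 0 with h | rfl | h
  · rw [stepCost, stepCost, if_pos (by omega), if_neg (by omega)]; push_cast; ring
  · simp [stepCost]
  · rw [stepCost, stepCost, if_neg (by omega), if_pos (by omega)]; push_cast; ring

/-- Signed flows cost no less to first order than their absolute values: a change of direction moves
further than the change of the absolute value. -/
theorem stepCost_le_deviationCost {ρ : ℝ} (hρ : 0 ≤ ρ) (f g : ℤ) :
    EdgeGraph.stepCost (resourcePotential ρ |f + 1| - resourcePotential ρ |f|)
      (resourcePotential ρ |f - 1| - resourcePotential ρ |f|) (g - f) ≤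
        deviationCost ρ |f| |g| := by
  wlog hf : 0 ≤ f generalizing f g
  · have := this (-f) (-g) (by omega)
    rw [show -f + 1 = -(f - 1) by ring, show -f - 1 = -(f + 1) by ring,
      show -g - -f = -(g - f) by ring, EdgeGraph.stepCost_neg] at this
    simpa only [abs_neg] using this
  rw [abs_of_nonneg hf, abs_of_nonneg (show 0 ≤ f + 1 by omega)]
  rcases hf.eq_or_lt with rfl | hf'
  · rw [deviationCost_of_le (abs_nonneg g)]
    rcases le_or_gt 0 g with hg | hg
    · rw [EdgeGraph.stepCost, if_pos (by omega), abs_of_nonneg hg]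
      simp [resourcePotential]
    · rw [EdgeGraph.stepCost, if_neg (by omega), abs_of_neg hg]
      simp [resourcePotential]
  rw [abs_of_nonneg (show 0 ≤ f - 1 by omega)]
  have h1 : (0 : ℝ) ≤ f - 1 := by
    rw [sub_nonneg]; exact_mod_cast (show (1 : ℤ) ≤ f by omega)
  have hq : resourcePotential ρ (f - 1) - resourcePotential ρ f =
      -(1 + ρ * (f - 1)) := by
    simp only [resourcePotential]; push_cast; ring
  have hp : resourcePotential ρ (f + 1) - resourcePotential ρ f = 1 + ρ * f := by
    simp only [resourcePotential]; push_cast; ring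
  have hq0 : 0 ≤ 1 + ρ * ((f : ℝ) - 1) := by positivity
  rw [hp, hq]
  rcases le_or_gt 0 g with hg | hg
  · rw [abs_of_nonneg hg, deviationCost]
  · rw [EdgeGraph.stepCost, if_neg (by omega), abs_of_neg hg]
    have hg' : (g : ℝ) < 0 := by exact_mod_cast hg
    rcases le_or_gt f (-g) with h | h
    · have h2 : (f : ℝ) ≤ -g := by exact_mod_cast h
      rw [deviationCost_of_le h]
      push_cast
      have : 0 ≤ (-(g : ℝ) - f) * (1 + ρ * f) :=
        mul_nonneg (by linarith) (by nlinarith)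
      nlinarith
    · rw [deviationCost_of_lt h]
      push_cast
      nlinarith

namespace EdgeGraph

variable {V E : Type u} {G : EdgeGraph V E} {k : EdgeKind} [Fintype E]

/-- A flow that minimizes the potential satisfies the variational inequality against every other
flow `g`: adding to it any of the cycles into which `g - f` decomposes gives a flow again. -/
theorem IsFlow.sum_deviationCost_nonneg [Finite V] {ρ : ℝ} (hρ : 0 ≤ ρ) {a : E → ℝ}
    (ha : ∀ e, 0 ≤ a e) {s t : V} {n : ℕ} {f g : E → ℤ} (hf : G.IsFlow k s t n f)
    (hg : G.IsFlow k s t n g)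
    (hmin : ∀ f', G.IsFlow k s t n f' → ∑ e, a e * resourcePotential ρ |f e| ≤
      ∑ e, a e * resourcePotential ρ |f' e|) :
    0 ≤ ∑ e, a e * deviationCost ρ |f e| |g e| := by
  have key : 0 ≤ ∑ e, stepCost
      (a e * (resourcePotential ρ |f e + 1| - resourcePotential ρ |f e|))
      (a e * (resourcePotential ρ |f e - 1| - resourcePotential ρ |f e|)) ((g - f) e) := by
    refine stepCost_nonneg_of_cycles _ _ _
      (by rw [netOut_sub, hf.netOut_eq, hg.netOut_eq, sub_self]) fun c hc0 hc => ?_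
    have hsign : ∀ e, c e = 0 ∨ (c e = 1 ∧ f e < g e) ∨ (c e = -1 ∧ g e < f e) := fun e => by
      rcases hc e with h0 | ⟨h0, h1⟩
      · exact Or.inl h0
      · rw [Pi.sub_apply] at h0 h1
        rcases lt_or_gt_of_ne h0 with h2 | h2
        · exact Or.inr (Or.inr ⟨by rw [h1, Int.sign_eq_neg_one_of_neg h2], by omega⟩)
        · exact Or.inr (Or.inl ⟨by rw [h1, Int.sign_eq_one_of_pos h2], by omega⟩)
    have hflow : G.IsFlow k s t n (f + c) := by
      refine ⟨fun hk e => ?_, by rw [netOut_add, hf.netOut_eq, hc0, add_zero]⟩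
      have h0 := hf.nonneg hk e
      have h1 := hg.nonneg hk e
      rw [Pi.add_apply]
      have := hsign e
      omega
    have := sub_nonneg.2 (hmin _ hflow)
    rw [← Finset.sum_sub_distrib] at this
    refine this.trans_eq (Finset.sum_congr rfl fun e _ => ?_)
    rw [Pi.add_apply]
    rcases hsign e with h0 | ⟨h0, -⟩ | ⟨h0, -⟩
    · simp [h0, stepCost]
    · rw [h0, stepCost, if_pos (by norm_num)]
      push_cast; ring
    · rw [h0, stepCost, if_neg (by norm_num), ← sub_eq_add_neg]
      push_cast; ring
  refine key.trans (Finset.sum_le_sum fun e _ => ?_)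
  have h := mul_le_mul_of_nonneg_left (stepCost_le_deviationCost hρ (f e) (g e)) (ha e)
  refine (le_of_eq ?_).trans h
  unfold stepCost
  rw [Pi.sub_apply]
  split_ifs <;> ring

end EdgeGraph

/-! ### Potential and equilibria -/

namespace AffineCongestionGame

variable {Γ : AffineCongestionGame.{u}}

/-- The load of a resource caused by the players other than `i`. -/
def restLoad (s : Γ.Profile) (i : Fin Γ.n) (e : Γ.Res) : ℕ :=
  (Finset.univ.filter fun j => j ≠ i ∧ e ∈ (s j : Finset Γ.Res)).card

theorem load_eq_restLoad (s : Γ.Profile) (i : Fin Γ.n) (e : Γ.Res) :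
    Γ.load s e = restLoad s i e + if e ∈ (s i : Finset Γ.Res) then 1 else 0 := by
  rw [load, restLoad, Finset.card_filter, Finset.card_filter, ← Finset.add_sum_erase _ _
    (Finset.mem_univ i), ← Finset.add_sum_erase _ _ (Finset.mem_univ i), add_comm]
  simp only [ne_eq, not_true, false_and, if_false, zero_add]
  congr 1
  exact Finset.sum_congr rfl fun j hj => by simp [Finset.ne_of_mem_erase hj]

theorem restLoad_update (s : Γ.Profile) (i : Fin Γ.n) (t : Γ.strat i) :
    restLoad (Function.update s i t) i = restLoad s i := by
  funext e
  unfold restLoad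
  congr 1
  refine Finset.filter_congr fun j _ => and_congr_right fun hj => ?_
  rw [Function.update_of_ne hj]

theorem playerCost_eq (hlin : Γ.IsLinear) (ρ : ℝ) (s : Γ.Profile) (i : Fin Γ.n) :
    Γ.playerCost ρ s i = ∑ e ∈ (s i : Finset Γ.Res), Γ.a e * (1 + ρ * restLoad s i e) := by
  refine Finset.sum_congr rfl fun e he => ?_
  rw [hlin e, load_eq_restLoad s i, if_pos he]
  push_cast; ring

theorem playerCost_update (hlin : Γ.IsLinear) (ρ : ℝ) (s : Γ.Profile) (i : Fin Γ.n)
    (t : Γ.strat i) :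
    Γ.playerCost ρ (Function.update s i t) i =
      ∑ e ∈ (t : Finset Γ.Res), Γ.a e * (1 + ρ * restLoad s i e) := by
  rw [playerCost_eq hlin, restLoad_update, Function.update_self]

theorem socialCost_eq (hlin : Γ.IsLinear) (s : Γ.Profile) :
    Γ.socialCost 1 s = ∑ e, Γ.a e * (Γ.load s e : ℝ) ^ 2 := by
  have h : ∀ i, Γ.playerCost 1 s i =
      ∑ e, if e ∈ (s i : Finset Γ.Res) then Γ.a e * (Γ.load s e : ℝ) else 0 := fun i => by
    rw [Finset.sum_ite_mem, Finset.univ_inter]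
    exact Finset.sum_congr rfl fun e _ => by rw [hlin e]; ring
  simp only [socialCost, h]
  rw [Finset.sum_comm]
  refine Finset.sum_congr rfl fun e _ => ?_
  rw [← Finset.sum_filter, Finset.sum_const, nsmul_eq_mul, load]
  ring

/-- Rosenthal's potential of a linear game for the player costs `C_i^ρ`. -/
noncomputable def potential (Γ : AffineCongestionGame.{u}) (ρ : ℝ) (s : Γ.Profile) : ℝ :=
  ∑ e, Γ.a e * resourcePotential ρ (Γ.load s e)

theorem potential_eq (hlin : Γ.IsLinear) (ρ : ℝ) (s : Γ.Profile) (i : Fin Γ.n) :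
    Γ.potential ρ s =
      ∑ e, Γ.a e * resourcePotential ρ (restLoad s i e) + Γ.playerCost ρ s i := by
  rw [playerCost_eq hlin, ← Finset.univ_inter (s i : Finset Γ.Res), ← Finset.sum_ite_mem,
    ← Finset.sum_add_distrib]
  refine Finset.sum_congr rfl fun e _ => ?_
  rw [load_eq_restLoad s i]
  unfold resourcePotential
  split_ifs <;> push_cast <;> ring

theorem isNash_of_potential_le (hlin : Γ.IsLinear) {ρ : ℝ} {s : Γ.Profile}
    (h : ∀ s', Γ.potential ρ s ≤ Γ.potential ρ s') : Γ.IsNash ρ s := fun i t => by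
  have := h (Function.update s i t)
  rw [potential_eq hlin ρ s i, potential_eq hlin ρ (Function.update s i t) i,
    restLoad_update] at this
  linarith

instance finite_profile : Finite Γ.Profile := Pi.finite

theorem exists_potential_min [Nonempty Γ.Profile] (ρ : ℝ) :
    ∃ s, ∀ s', Γ.potential ρ s ≤ Γ.potential ρ s' :=
  Finite.exists_min _

theorem exists_optCost_eq [Nonempty Γ.Profile] (σ : ℝ) :
    ∃ s, Γ.optCost σ = ENNReal.ofReal (Γ.socialCost σ s) := by
  obtain ⟨s, hs⟩ := exists_eq_ciInf_of_finite (f := fun s => ENNReal.ofReal (Γ.socialCost σ s))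
  exact ⟨s, hs.symm⟩

theorem optCost_eq_top [IsEmpty Γ.Profile] (σ : ℝ) : Γ.optCost σ = ⊤ := by simp [optCost]

theorem PoS_le_of_exists {ρ β : ℝ} (hβ : 0 ≤ β)
    (h : Nonempty Γ.Profile →
      ∃ s, Γ.IsNash ρ s ∧ ∀ y, Γ.socialCost 1 s ≤ β * Γ.socialCost 1 y) :
    Γ.PoS ρ 1 ≤ ENNReal.ofReal β := by
  rcases isEmpty_or_nonempty Γ.Profile with hempty | hne
  · simp [PoS, optCost_eq_top]
  · obtain ⟨s, hs, hle⟩ := h hne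
    obtain ⟨y, hy⟩ := exists_optCost_eq (Γ := Γ) 1
    refine ENNReal.div_le_of_le_mul ((iInf₂_le s hs).trans ?_)
    rw [hy, ← ENNReal.ofReal_mul hβ]
    exact ENNReal.ofReal_le_ofReal (hle y)

theorem PoA_le_of_forall {ρ β : ℝ} (hβ : 0 ≤ β)
    (h : ∀ s, Γ.IsNash ρ s → ∀ y, Γ.socialCost 1 s ≤ β * Γ.socialCost 1 y) :
    Γ.PoA ρ 1 ≤ ENNReal.ofReal β := by
  rcases isEmpty_or_nonempty Γ.Profile with hempty | hne
  · simp [PoA, optCost_eq_top]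
  · obtain ⟨y, hy⟩ := exists_optCost_eq (Γ := Γ) 1
    refine ENNReal.div_le_of_le_mul (iSup₂_le fun s hs => ?_)
    rw [hy, ← ENNReal.ofReal_mul hβ]
    exact ENNReal.ofReal_le_ofReal (h s hs y)

theorem PoS_le_PoA [Nonempty Γ.Profile] (hlin : Γ.IsLinear) (ρ σ : ℝ) :
    Γ.PoS ρ σ ≤ Γ.PoA ρ σ := by
  obtain ⟨s, hs⟩ := exists_potential_min (Γ := Γ) ρ
  have hN := isNash_of_potential_le hlin hs
  refine ENNReal.div_le_div_right ?_ _
  exact (iInf₂_le s hN).trans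
    (le_iSup₂ (f := fun s (_ : Γ.IsNash ρ s) => ENNReal.ofReal (Γ.socialCost σ s)) s hN)

theorem perceptionBound_zero : perceptionBound 0 = ⊤ := by
  simp [perceptionBound, ENNReal.div_zero]

/-- The equilibrium decomposes into paths a flow of minimum potential. Such a flow exists among
those that arise from the profiles, since every flow dominates the loads of some profile. -/
theorem PoS_le_of_isNetwork {ρ : ℝ} (hρ : 0 ≤ ρ) {k : EdgeKind} (hlin : Γ.IsLinear)
    (hsym : Γ.IsSymmetric) (hnet : Γ.IsNetwork k) : Γ.PoS ρ 1 ≤ perceptionBound ρ := by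
  rcases hρ.eq_or_lt with rfl | hρ'
  · simp [perceptionBound_zero]
  obtain ⟨β, c, hβ, hc, hB, hsm⟩ := exists_smoothness hρ'
  rw [hB]
  refine PoS_le_of_exists hβ fun hne => ?_
  obtain ⟨s₀, hs₀⟩ := exists_potential_min (Γ := Γ) ρ
  rcases Nat.eq_zero_or_pos Γ.n with hn | hn
  · have : IsEmpty (Fin Γ.n) := by rw [hn]; infer_instance
    exact ⟨s₀, fun i => isEmptyElim i, fun y => by simp [socialCost]⟩
  obtain ⟨V, _, G, st, tt, hst⟩ := hnet
  have hpaths : ∀ i, Γ.strat i = G.paths k (st ⟨0, hn⟩) (tt ⟨0, hn⟩) := fun i => by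
    rw [hsym i ⟨0, hn⟩, hst]
  have toFlow : ∀ s : Γ.Profile, ∃ f, G.IsFlow k (st ⟨0, hn⟩) (tt ⟨0, hn⟩) Γ.n f ∧
      ∀ e, |f e| ≤ (Γ.load s e : ℤ) := fun s =>
    EdgeGraph.exists_flow_of_paths (fun i => (s i : Finset Γ.Res)) fun i => hpaths i ▸ (s i).2
  have ofFlow : ∀ f, G.IsFlow k (st ⟨0, hn⟩) (tt ⟨0, hn⟩) Γ.n f → ∃ s : Γ.Profile,
      ∀ e, (Γ.load s e : ℤ) ≤ |f e| := fun f hf => by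
    obtain ⟨P, hP, hle⟩ := hf.exists_paths
    exact ⟨fun i => ⟨P i, by rw [hpaths i]; exact hP i⟩, hle⟩
  have hmono : ∀ x y : Γ.Res → ℤ, (∀ e, 0 ≤ x e) → (∀ e, x e ≤ y e) →
      ∑ e, Γ.a e * resourcePotential ρ (x e) ≤ ∑ e, Γ.a e * resourcePotential ρ (y e) :=
    fun x y hx hxy => Finset.sum_le_sum fun e _ =>
      mul_le_mul_of_nonneg_left (resourcePotential_mono hρ (hx e) (hxy e)) (Γ.a_nonneg e)
  have hsq : ∀ x y : Γ.Res → ℤ, (∀ e, 0 ≤ x e) → (∀ e, x e ≤ y e) →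
      ∑ e, Γ.a e * (x e : ℝ) ^ 2 ≤ ∑ e, Γ.a e * (y e : ℝ) ^ 2 :=
    fun x y hx hxy => Finset.sum_le_sum fun e _ =>
      mul_le_mul_of_nonneg_left (pow_le_pow_left₀ (by exact_mod_cast hx e)
        (by exact_mod_cast hxy e) 2) (Γ.a_nonneg e)
  obtain ⟨f, hf, hfle⟩ := toFlow s₀
  have hf₀ := hmono _ _ (fun e => abs_nonneg (f e)) hfle
  have hmin : ∀ f', G.IsFlow k (st ⟨0, hn⟩) (tt ⟨0, hn⟩) Γ.n f' →
      ∑ e, Γ.a e * resourcePotential ρ |f e| ≤ ∑ e, Γ.a e * resourcePotential ρ |f' e| := by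
    intro f' hf'
    obtain ⟨s', hs'⟩ := ofFlow f' hf'
    exact hf₀.trans ((hs₀ s').trans (hmono _ _ (fun e => by positivity) hs'))
  obtain ⟨s, hs⟩ := ofFlow f hf
  refine ⟨s, isNash_of_potential_le hlin fun s' => ?_, fun y => ?_⟩
  · exact ((hmono _ _ (fun e => by positivity) hs).trans hf₀).trans (hs₀ s')
  · obtain ⟨g, hg, hgle⟩ := toFlow y
    have h1 := hsq _ _ (fun e => by positivity) hs
    have h2 := sum_sq_le_of_deviationCost hc hsm Γ.a_nonneg (fun e => abs_nonneg (f e))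
      (fun e => abs_nonneg (g e)) (hf.sum_deviationCost_nonneg hρ Γ.a_nonneg hg hmin)
    have h3 := hsq _ _ (fun e => abs_nonneg (g e)) hgle
    rw [socialCost_eq hlin, socialCost_eq hlin]
    simp only [Int.cast_natCast] at h1 h3
    exact (h1.trans h2).trans (mul_le_mul_of_nonneg_left h3 hβ)

end AffineCongestionGame

/-! ### Equilibria of extension-parallel path families -/

/-- `ExtParFamily F P`: the family `P` of subsets of `F` arises as the family of paths of an
extension-parallel graph with edge set `F`, with the graph itself forgotten. -/
inductive ExtParFamily {E : Type u} [DecidableEq E] : Finset E → Set (Finset E) → Prop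
  | single (e : E) : ExtParFamily {e} {{e}}
  | series {e : E} {F : Finset E} {P : Set (Finset E)} (he : e ∉ F) (h : ExtParFamily F P) :
      ExtParFamily (insert e F) (insert e '' P)
  | union {F₁ F₂ : Finset E} {P₁ P₂ : Set (Finset E)} (hF : Disjoint F₁ F₂)
      (h₁ : ExtParFamily F₁ P₁) (h₂ : ExtParFamily F₂ P₂) : ExtParFamily (F₁ ∪ F₂) (P₁ ∪ P₂)

namespace ExtParFamily

variable {E : Type u} [DecidableEq E] {F : Finset E} {P : Set (Finset E)}

theorem subset (h : ExtParFamily F P) : ∀ r ∈ P, r ⊆ F := by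
  induction h with
  | single e => simp
  | series he h ih =>
    rintro _ ⟨r, hr, rfl⟩
    exact Finset.insert_subset_insert _ (ih r hr)
  | union hF h₁ h₂ ih₁ ih₂ =>
    rintro r (hr | hr)
    · exact (ih₁ r hr).trans Finset.subset_union_left
    · exact (ih₂ r hr).trans Finset.subset_union_right

theorem nonempty (h : ExtParFamily F P) : ∀ r ∈ P, r.Nonempty := by
  induction h with
  | single e => simp
  | series he h ih =>
    rintro _ ⟨r, hr, rfl⟩
    exact Finset.insert_nonempty _ _
  | union hF h₁ h₂ ih₁ ih₂ =>
    rintro r (hr | hr)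
    · exact ih₁ r hr
    · exact ih₂ r hr

variable {ι : Type*} {F₁ F₂ : Finset E} {P₁ P₂ : Set (Finset E)}

/-- In a component with edge set `F` and path family `P`, the players in `I` use a path of the
component and the other players use none of its edges. -/
def Uses (F : Finset E) (P : Set (Finset E)) (p : ι → Finset E) (I : Finset ι) : Prop :=
  (∀ i ∈ I, p i ∩ F ∈ P) ∧ ∀ i ∉ I, p i ∩ F = ∅

theorem Uses.of_insert {e : E} {p : ι → Finset E} {I : Finset ι} (h : ExtParFamily F P)
    (he : e ∉ F) (hu : Uses (insert e F) (insert e '' P) p I) :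
    Uses F P p I ∧ (∀ i ∈ I, e ∈ p i) ∧ ∀ i ∉ I, e ∉ p i := by
  have hsub : ∀ i, p i ∩ F = (p i ∩ insert e F).erase e := fun i => by
    ext f
    by_cases hf : f = e
    · subst hf; simp [he]
    · simp [hf]
  refine ⟨⟨fun i hi => ?_, fun i hi => ?_⟩, fun i hi => ?_, fun i hi hei => ?_⟩
  · obtain ⟨r, hr, hre⟩ := hu.1 i hi
    rw [hsub, ← hre, Finset.erase_insert fun h' => he (h.subset r hr h')]
    exact hr
  · rw [hsub, hu.2 i hi]; simp
  · obtain ⟨r, hr, hre⟩ := hu.1 i hi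
    exact Finset.mem_of_mem_inter_left (hre ▸ Finset.mem_insert_self e r)
  · have : e ∈ p i ∩ insert e F := by simp [hei]
    simp [hu.2 i hi] at this

theorem Uses.of_union {p : ι → Finset E} {I : Finset ι} (h₁ : ExtParFamily F₁ P₁)
    (h₂ : ExtParFamily F₂ P₂) (hF : Disjoint F₁ F₂) (hu : Uses (F₁ ∪ F₂) (P₁ ∪ P₂) p I) :
    ∃ I₁ ⊆ I, ∃ I₂ ⊆ I, I₁.card + I₂.card = I.card ∧ Uses F₁ P₁ p I₁ ∧ Uses F₂ P₂ p I₂ ∧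
      (∀ i ∈ I₁, p i ∩ F₂ = ∅) ∧ ∀ i ∈ I₂, p i ∩ F₁ = ∅ := by
  classical
  have hc : ∀ i ∈ I, (p i ∩ F₁ ∈ P₁ ∧ p i ∩ F₂ = ∅) ∨ (p i ∩ F₂ ∈ P₂ ∧ p i ∩ F₁ = ∅) := by
    intro i hi
    have key : ∀ {F F' : Finset E}, Disjoint F F' → p i ∩ (F ∪ F') ⊆ F → p i ∩ F' = ∅ := by
      intro F F' hd hs
      refine Finset.eq_empty_of_forall_notMem fun e he => ?_
      rw [Finset.mem_inter] at he
      exact Finset.disjoint_left.1 hd (hs (by simp [he])) he.2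
    rcases hu.1 i hi with hr | hr
    · have h3 := key hF (h₁.subset _ hr)
      rw [Finset.inter_union_distrib_left, h3, Finset.union_empty] at hr
      exact Or.inl ⟨hr, h3⟩
    · rw [Finset.union_comm] at hr
      have h3 := key hF.symm (h₂.subset _ hr)
      rw [Finset.inter_union_distrib_left, h3, Finset.union_empty] at hr
      exact Or.inr ⟨hr, h3⟩
  have hn₁ : ∀ i, p i ∩ F₁ ∈ P₁ → p i ∩ F₁ ≠ ∅ := fun i hi => (h₁.nonempty _ hi).ne_empty
  have hout : ∀ i ∉ I, p i ∩ F₁ = ∅ ∧ p i ∩ F₂ = ∅ := fun i hi => by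
    have := hu.2 i hi
    rwa [Finset.inter_union_distrib_left, Finset.union_eq_empty] at this
  have hmem₂ : ∀ i, i ∈ I.filter (fun i => ¬ p i ∩ F₁ ∈ P₁) → p i ∩ F₂ ∈ P₂ ∧ p i ∩ F₁ = ∅ :=
    fun i hi => by
      rw [Finset.mem_filter] at hi
      exact (hc i hi.1).resolve_left fun h => hi.2 h.1
  have hmem₁ : ∀ i, i ∈ I.filter (fun i => p i ∩ F₁ ∈ P₁) → p i ∩ F₁ ∈ P₁ ∧ p i ∩ F₂ = ∅ :=
    fun i hi => by
      rw [Finset.mem_filter] at hi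
      exact (hc i hi.1).resolve_right fun h => hn₁ i hi.2 h.2
  refine ⟨I.filter fun i => p i ∩ F₁ ∈ P₁, Finset.filter_subset _ _,
    I.filter fun i => ¬ p i ∩ F₁ ∈ P₁, Finset.filter_subset _ _,
    Finset.card_filter_add_card_filter_not _, ⟨fun i hi => (hmem₁ i hi).1, fun i hi => ?_⟩,
    ⟨fun i hi => (hmem₂ i hi).1, fun i hi => ?_⟩, fun i hi => (hmem₁ i hi).2,
    fun i hi => (hmem₂ i hi).2⟩
  · by_cases hiI : i ∈ I
    · exact ((hc i hiI).resolve_left fun h => hi (by simp [hiI, h.1])).2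
    · exact (hout i hiI).1
  · by_cases hiI : i ∈ I
    · have : p i ∩ F₁ ∈ P₁ := by simpa [hiI] using hi
      exact (hmem₁ i (by simp [hiI, this])).2
    · exact (hout i hiI).2

/-- If all values of `u` on `I` lie below all values of `w` on `P`, then a number between them can
be chosen on the prescribed side of `L`. -/
theorem exists_threshold {α : Type*} {I : Finset ι} (hI : I.Nonempty) {P : Set α} {u : ι → ℝ}
    {w : α → ℝ} (h : ∀ i ∈ I, ∀ r ∈ P, u i ≤ w r) {δ L : ℝ} (h₁ : 0 < δ → ∀ r ∈ P, L ≤ w r)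
    (h₂ : δ < 0 → ∀ i ∈ I, u i ≤ L) :
    ∃ M, (∀ r ∈ P, M ≤ w r) ∧ (∀ i ∈ I, u i ≤ M) ∧ δ * L ≤ δ * M := by
  obtain ⟨j, hj, hmax⟩ := Finset.exists_max_image I u hI
  rcases lt_trichotomy δ 0 with h0 | h0 | h0
  · exact ⟨u j, h j hj, hmax, mul_le_mul_of_nonpos_left (h₂ h0 j hj) h0.le⟩
  · exact ⟨u j, h j hj, hmax, by simp [h0]⟩
  · exact ⟨max L (u j), fun r hr => max_le (h₁ h0 r hr) (h j hj r hr),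
      fun i hi => (hmax i hi).trans (le_max_right _ _),
      mul_le_mul_of_nonneg_left (le_max_left _ _) h0.le⟩

theorem stepCost_edge {e : E} {cp cm : E → ℝ} [Fintype ι] {p q : ι → Finset E} {I K : Finset ι}
    (hp : ∀ i, i ∈ I ↔ e ∈ p i) (hq : ∀ i, i ∈ K ↔ e ∈ q i) :
    (I.card ≤ K.card → EdgeGraph.stepCost (cp e) (-cm e)
      (((Finset.univ.filter fun i => e ∈ q i).card : ℤ) -
        ((Finset.univ.filter fun i => e ∈ p i).card : ℤ)) = ((K.card : ℝ) - I.card) * cp e) ∧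
    (K.card ≤ I.card → EdgeGraph.stepCost (cp e) (-cm e)
      (((Finset.univ.filter fun i => e ∈ q i).card : ℤ) -
        ((Finset.univ.filter fun i => e ∈ p i).card : ℤ)) = ((K.card : ℝ) - I.card) * cm e) := by
  have h1 : (Finset.univ.filter fun i => e ∈ p i) = I := by ext i; simp [hp]
  have h2 : (Finset.univ.filter fun i => e ∈ q i) = K := by ext i; simp [hq]
  rw [h1, h2]
  refine ⟨fun h => ?_, fun h => ?_⟩
  · rw [EdgeGraph.stepCost, if_pos (by omega)]; push_cast; ring
  · rcases h.eq_or_lt with h | h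
    · simp [h, EdgeGraph.stepCost]
    · rw [EdgeGraph.stepCost, if_neg (by omega)]; push_cast; ring

/-- The variational inequality on a component, for an equilibrium `p` with users `I` and any profile
`q` with users `K`. Joining an edge costs `cp`, leaving it saves `cm`. If the component has more
users in `q`, then each additional user pays at least a lower bound `L` of the costs of its paths; if
it has fewer, then each missing user saves at most an upper bound `L` of the costs of its users. In a
parallel composition where the surplus and the deficit are in different components, the equilibrium
condition separates the two costs. -/
theorem le_sum_stepCost [Fintype ι] {cp cm : E → ℝ} {p q : ι → Finset E}
    (h : ExtParFamily F P) (I K : Finset ι) (hI : Uses F P p I) (hK : Uses F P q K)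
    (hN : ∀ i ∈ I, ∀ r ∈ P, ∑ e ∈ (p i ∩ F) \ r, cm e ≤ ∑ e ∈ r \ p i, cp e) (L : ℝ)
    (hL₁ : I.card < K.card → ∀ r ∈ P, L ≤ ∑ e ∈ r, cp e)
    (hL₂ : K.card < I.card → ∀ i ∈ I, ∑ e ∈ p i ∩ F, cm e ≤ L) :
    ((K.card : ℝ) - I.card) * L ≤ ∑ e ∈ F, EdgeGraph.stepCost (cp e) (-cm e)
      (((Finset.univ.filter fun i => e ∈ q i).card : ℤ) -
        ((Finset.univ.filter fun i => e ∈ p i).card : ℤ)) := by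
  have hpos : ∀ {m n : ℕ}, m < n → (0 : ℝ) < n - m := fun h => by
    rw [sub_pos]; exact_mod_cast h
  induction h generalizing I K L with
  | single e =>
    have hiff : ∀ {p : ι → Finset E} {I : Finset ι}, Uses {e} {{e}} p I →
        ∀ i, i ∈ I ↔ e ∈ p i := by
      intro p I hI i
      refine ⟨fun hi => ?_, fun hi => by_contra fun hiI => ?_⟩
      · have := hI.1 i hi
        rw [Set.mem_singleton_iff] at this
        exact Finset.mem_of_mem_inter_left (this ▸ Finset.mem_singleton_self e)
      · have h1 := hI.2 i hiI
        have h2 : e ∈ p i ∩ {e} := by simp [hi]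
        simp [h1] at h2
    have hedge := stepCost_edge (cp := cp) (cm := cm) (hiff hI) (hiff hK)
    rw [Finset.sum_singleton]
    rcases lt_trichotomy I.card K.card with hlt | heq | hgt
    · rw [hedge.1 hlt.le]
      refine mul_le_mul_of_nonneg_left ?_ (hpos hlt).le
      simpa using hL₁ hlt {e} rfl
    · rw [hedge.1 heq.le, heq]; simp
    · rw [hedge.2 hgt.le]
      obtain ⟨i, hi⟩ := Finset.card_pos.1 (Nat.zero_lt_of_lt hgt)
      have h1 := hL₂ hgt i hi
      have h2 : p i ∩ {e} = {e} := hI.1 i hi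
      rw [h2, Finset.sum_singleton] at h1
      nlinarith [hpos hgt]
  | @series e F P he h ih =>
    obtain ⟨hI', hIe, hIe'⟩ := Uses.of_insert h he hI
    obtain ⟨hK', hKe, hKe'⟩ := Uses.of_insert h he hK
    have hedge := stepCost_edge (cp := cp) (cm := cm) (p := p) (q := q) (e := e) (I := I) (K := K)
      (fun i => ⟨hIe i, fun h => by_contra fun h' => hIe' i h' h⟩)
      (fun i => ⟨hKe i, fun h => by_contra fun h' => hKe' i h' h⟩)
    have hN' : ∀ i ∈ I, ∀ r ∈ P, ∑ e ∈ (p i ∩ F) \ r, cm e ≤ ∑ e ∈ r \ p i, cp e := by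
      intro i hi r hr
      have h1 := hN i hi _ ⟨r, hr, rfl⟩
      have h2 : (p i ∩ insert e F) \ insert e r = (p i ∩ F) \ r := by
        ext f
        by_cases hf : f = e
        · subst hf; simp [he]
        · simp [hf]
      rwa [h2, Finset.insert_sdiff_of_mem _ (hIe i hi)] at h1
    have her : ∀ r ∈ P, e ∉ r := fun r hr h' => he (h.subset r hr h')
    rw [Finset.sum_insert he]
    rcases lt_trichotomy I.card K.card with hlt | heq | hgt
    · rw [hedge.1 hlt.le]
      have := ih I K hI' hK' hN' (L - cp e)
        (fun _ r hr => by
          have h1 := hL₁ hlt _ ⟨r, hr, rfl⟩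
          rw [Finset.sum_insert (her r hr)] at h1
          linarith) (fun h => by omega)
      linarith
    · rw [hedge.1 heq.le]
      have := ih I K hI' hK' hN' 0 (fun h => by omega) (fun h => by omega)
      rw [heq] at this ⊢
      simpa using this
    · rw [hedge.2 hgt.le]
      have := ih I K hI' hK' hN' (L - cm e) (fun h => by omega)
        (fun _ i hi => by
          have h1 := hL₂ hgt i hi
          rw [Finset.inter_insert_of_mem (hIe i hi),
            Finset.sum_insert (by simp [he])] at h1
          linarith)
      linarith
  | @union F₁ F₂ P₁ P₂ hF h₁ h₂ ih₁ ih₂ =>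
    obtain ⟨I₁, hI₁, I₂, hI₂, hIc, hu₁, hu₂, hx₁, hx₂⟩ := Uses.of_union h₁ h₂ hF hI
    obtain ⟨K₁, -, K₂, -, hKc, hv₁, hv₂, -, -⟩ := Uses.of_union h₁ h₂ hF hK
    have hp₁ : ∀ i ∈ I₁, p i ∩ (F₁ ∪ F₂) = p i ∩ F₁ := fun i hi => by
      rw [Finset.inter_union_distrib_left, hx₁ i hi, Finset.union_empty]
    have hp₂ : ∀ i ∈ I₂, p i ∩ (F₁ ∪ F₂) = p i ∩ F₂ := fun i hi => by
      rw [Finset.inter_union_distrib_left, hx₂ i hi, Finset.empty_union]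
    have hdisj : ∀ {r A B : Finset E}, r ⊆ B → A ∩ B = ∅ → r \ A = r := fun hr hAB =>
      Finset.sdiff_eq_self_of_disjoint <| Finset.disjoint_left.2 fun e he hA => by
        have := Finset.mem_inter.2 ⟨hA, hr he⟩
        simp [hAB] at this
    have cross₁ : ∀ i ∈ I₁, ∀ r ∈ P₂, ∑ e ∈ p i ∩ F₁, cm e ≤ ∑ e ∈ r, cp e := by
      intro i hi r hr
      have h3 := hN i (hI₁ hi) r (Or.inr hr)
      rwa [hp₁ i hi, hdisj (h₂.subset r hr) (hx₁ i hi), Finset.sdiff_eq_self_of_disjoint] at h3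
      exact Finset.disjoint_of_subset_left Finset.inter_subset_right
        (Finset.disjoint_of_subset_right (h₂.subset r hr) hF)
    have cross₂ : ∀ i ∈ I₂, ∀ r ∈ P₁, ∑ e ∈ p i ∩ F₂, cm e ≤ ∑ e ∈ r, cp e := by
      intro i hi r hr
      have h3 := hN i (hI₂ hi) r (Or.inl hr)
      rwa [hp₂ i hi, hdisj (h₁.subset r hr) (hx₂ i hi), Finset.sdiff_eq_self_of_disjoint] at h3
      exact Finset.disjoint_of_subset_left Finset.inter_subset_right
        (Finset.disjoint_of_subset_right (h₁.subset r hr) hF.symm)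
    have hIc' : (I.card : ℝ) = I₁.card + I₂.card := by exact_mod_cast hIc.symm
    have hKc' : (K.card : ℝ) = K₁.card + K₂.card := by exact_mod_cast hKc.symm
    have hδ₁ : 0 < (K.card : ℝ) - I.card → I.card < K.card := fun h => by
      exact_mod_cast sub_pos.1 h
    have hδ₂ : (K.card : ℝ) - I.card < 0 → K.card < I.card := fun h => by
      exact_mod_cast sub_neg.1 h
    obtain ⟨M, hM₁, hM₁', hM₂, hM₂', hM⟩ : ∃ M : ℝ,
        (I₁.card < K₁.card → ∀ r ∈ P₁, M ≤ ∑ e ∈ r, cp e) ∧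
        (K₁.card < I₁.card → ∀ i ∈ I₁, ∑ e ∈ p i ∩ F₁, cm e ≤ M) ∧
        (I₂.card < K₂.card → ∀ r ∈ P₂, M ≤ ∑ e ∈ r, cp e) ∧
        (K₂.card < I₂.card → ∀ i ∈ I₂, ∑ e ∈ p i ∩ F₂, cm e ≤ M) ∧
        ((K.card : ℝ) - I.card) * L ≤ ((K.card : ℝ) - I.card) * M := by
      have hLI₁ : K.card < I.card → ∀ i ∈ I₁, ∑ e ∈ p i ∩ F₁, cm e ≤ L := fun h i hi =>
        hp₁ i hi ▸ hL₂ h i (hI₁ hi)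
      have hLI₂ : K.card < I.card → ∀ i ∈ I₂, ∑ e ∈ p i ∩ F₂, cm e ≤ L := fun h i hi =>
        hp₂ i hi ▸ hL₂ h i (hI₂ hi)
      by_cases hA : I₁.card < K₁.card ∧ K₂.card < I₂.card
      · obtain ⟨M, h3, h4, h5⟩ := exists_threshold
          (Finset.card_pos.1 (Nat.zero_lt_of_lt hA.2)) cross₂
          (fun h r hr => hL₁ (hδ₁ h) r (Or.inl hr)) (fun h => hLI₂ (hδ₂ h))
        exact ⟨M, fun _ => h3, fun h => by omega, fun h => by omega, fun _ => h4, h5⟩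
      by_cases hB : I₂.card < K₂.card ∧ K₁.card < I₁.card
      · obtain ⟨M, h3, h4, h5⟩ := exists_threshold
          (Finset.card_pos.1 (Nat.zero_lt_of_lt hB.2)) cross₁
          (fun h r hr => hL₁ (hδ₁ h) r (Or.inr hr)) (fun h => hLI₁ (hδ₂ h))
        exact ⟨M, fun h => by omega, fun _ => h4, fun _ => h3, fun h => by omega, h5⟩
      · exact ⟨L, fun h r hr => hL₁ (by omega) r (Or.inl hr), fun h => hLI₁ (by omega),
          fun h r hr => hL₁ (by omega) r (Or.inr hr), fun h => hLI₂ (by omega), le_rfl⟩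
    have r₁ := ih₁ I₁ K₁ hu₁ hv₁
      (fun i hi r hr => hp₁ i hi ▸ hN i (hI₁ hi) r (Or.inl hr)) M hM₁ hM₁'
    have r₂ := ih₂ I₂ K₂ hu₂ hv₂
      (fun i hi r hr => hp₂ i hi ▸ hN i (hI₂ hi) r (Or.inr hr)) M hM₂ hM₂'
    rw [Finset.sum_union hF]
    rw [hIc', hKc'] at hM ⊢
    linarith

end ExtParFamily

/-! ### Paths of extension-parallel graphs -/

namespace EdgeGraph

variable {V E : Type u} {G : EdgeGraph V E} {k : EdgeKind}

theorem Joins.ends_mem_iff {e : E} {u v : V} (h : G.Joins k e u v) (W : Set V) :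
    (G.src e ∈ W ∧ G.tgt e ∈ W) ↔ (u ∈ W ∧ v ∈ W) := by
  cases k
  · obtain ⟨rfl, rfl⟩ := h; rfl
  · rcases h with ⟨rfl, rfl⟩ | ⟨rfl, rfl⟩
    · rfl
    · exact and_comm

theorem Joins.right_unique {e : E} {u v w : V} (h : G.Joins k e u v) (h' : G.Joins k e u w) :
    v = w := by
  cases k
  · exact h.2.symm.trans h'.2
  · rcases h with ⟨h1, h2⟩ | ⟨h1, h2⟩ <;> rcases h' with ⟨h3, h4⟩ | ⟨h3, h4⟩ <;> simp_all

theorem Joins.eq_or_eq {e : E} {u v m t : V} (h : G.Joins k e u v) (h' : G.Joins k e m t) :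
    (u = m ∧ v = t) ∨ (u = t ∧ v = m) := by
  cases k
  · exact Or.inl ⟨h.1.symm.trans h'.1, h.2.symm.trans h'.2⟩
  · rcases h with ⟨h1, h2⟩ | ⟨h1, h2⟩ <;> rcases h' with ⟨h3, h4⟩ | ⟨h3, h4⟩ <;> simp_all

theorem IsWalk.mem_of_ends_mem {u t : V} {vs : List V} {es : List E} (h : G.IsWalk k u t vs es)
    {W : Set V} (hu : u ∈ W) (he : ∀ e ∈ es, G.src e ∈ W ∧ G.tgt e ∈ W) : ∀ v ∈ vs, v ∈ W := by
  induction h with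
  | nil v => simpa using hu
  | @cons u v w e vs es h p ih =>
    have hv := ((h.ends_mem_iff W).1 (he e (by simp))).2
    intro x hx
    rcases List.mem_cons.1 hx with rfl | hx
    · exact hu
    · exact ih hv (fun e he' => he e (by simp [he'])) x hx

theorem IsWalk.concat {u m t : V} {vs : List V} {es : List E} {e : E}
    (p : G.IsWalk k u m vs es) (h : G.Joins k e m t) :
    G.IsWalk k u t (vs ++ [t]) (es ++ [e]) := by
  induction p with
  | nil v => exact .cons h (.nil t)
  | cons h' p ih => exact .cons h' (ih h)

theorem IsWalk.eq_nil {t : V} {vs : List V} {es : List E} (p : G.IsWalk k t t vs es)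
    (hn : vs.Nodup) : vs = [t] ∧ es = [] := by
  cases p with
  | nil => exact ⟨rfl, rfl⟩
  | cons h p => exact absurd p.end_mem (List.nodup_cons.1 hn).1

/-- A simple walk that starts in `W` and ends in a vertex outside of `W` that is attached to `W` by
the single edge `e` has `e` as its last edge. -/
theorem IsWalk.exists_concat {u t : V} {vs : List V} {es : List E} (p : G.IsWalk k u t vs es)
    (hn : vs.Nodup) {W : Set V} {F : Set E} (hF : ∀ f ∈ F, G.src f ∈ W ∧ G.tgt f ∈ W)
    {m : V} {e : E} (h : G.Joins k e m t) (hu : u ∈ W) (ht : t ∉ W)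
    (hes : ∀ f ∈ es, f ∈ insert e F) :
    ∃ vs' es', G.IsWalk k u m vs' es' ∧ vs = vs' ++ [t] ∧ es = es' ++ [e] ∧ ∀ f ∈ es', f ∈ F := by
  induction p with
  | nil v => exact absurd hu ht
  | @cons u v w f vs es h' p ih =>
    by_cases hf : f ∈ F
    · obtain ⟨vs', es', h1, h2, h3, h4⟩ := ih (List.nodup_cons.1 hn).2 h
        ((h'.ends_mem_iff W).1 (hF f hf)).2 ht (fun g hg => hes g (by simp [hg]))
      exact ⟨u :: vs', f :: es', .cons h' h1, by simp [h2], by simp [h3], by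
        simpa [hf] using h4⟩
    · obtain rfl : f = e := (hes f (by simp)).resolve_right hf
      rcases h'.eq_or_eq h with ⟨rfl, rfl⟩ | ⟨rfl, rfl⟩
      · obtain ⟨rfl, rfl⟩ := p.eq_nil (List.nodup_cons.1 hn).2
        exact ⟨[u], [], .nil u, rfl, rfl, by simp⟩
      · exact absurd hu ht

/-- In a parallel composition, a simple walk to `t` that has left `s` into one component stays
there. -/
theorem IsWalk.mem_of_parallel {s u t : V} {vs : List V} {es : List E}
    (p : G.IsWalk k u t vs es) (hn : vs.Nodup) {W₁ W₂ : Set V} {F₁ F₂ : Set E}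
    (hF₁ : ∀ f ∈ F₁, G.src f ∈ W₁ ∧ G.tgt f ∈ W₁) (hF₂ : ∀ f ∈ F₂, G.src f ∈ W₂ ∧ G.tgt f ∈ W₂)
    (hW : ∀ v ∈ W₁, v ∈ W₂ → v = s ∨ v = t) (hu : u ∈ W₁) (hs : s ∉ vs)
    (hes : ∀ f ∈ es, f ∈ F₁ ∨ f ∈ F₂) : ∀ f ∈ es, f ∈ F₁ := by
  induction p with
  | nil v => simp
  | @cons u v w f vs es h p ih =>
    have hf : f ∈ F₁ := by
      refine (hes f (by simp)).resolve_right fun hf => ?_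
      rcases hW u hu ((h.ends_mem_iff W₂).1 (hF₂ f hf)).1 with rfl | rfl
      · simp at hs
      · exact (List.nodup_cons.1 hn).1 p.end_mem
    have := ih (List.nodup_cons.1 hn).2 hW ((h.ends_mem_iff W₁).1 (hF₁ f hf)).2
      (fun h => hs (by simp [h])) fun g hg => hes g (by simp [hg])
    simpa [hf] using this

theorem paths_parallel {s t : V} {A : Finset E} (hA : A ∈ G.paths k s t) (hst : s ≠ t)
    {W₁ W₂ : Set V} {F₁ F₂ : Set E}
    (hF₁ : ∀ f ∈ F₁, G.src f ∈ W₁ ∧ G.tgt f ∈ W₁) (hF₂ : ∀ f ∈ F₂, G.src f ∈ W₂ ∧ G.tgt f ∈ W₂)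
    (hW : ∀ v ∈ W₁, v ∈ W₂ → v = s ∨ v = t) (hAF : ∀ f ∈ A, f ∈ F₁ ∨ f ∈ F₂) :
    (∀ f ∈ A, f ∈ F₁) ∨ ∀ f ∈ A, f ∈ F₂ := by
  obtain ⟨vs, es, p, hn, hes⟩ := hA
  simp only [hes] at hAF ⊢
  cases p with
  | nil => exact absurd rfl hst
  | @cons _ v _ f vs es h p =>
    obtain ⟨hs, hn⟩ := List.nodup_cons.1 hn
    have hrest : ∀ g ∈ es, g ∈ F₁ ∨ g ∈ F₂ := fun g hg => hAF g (by simp [hg])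
    rcases hAF f (by simp) with hf | hf
    · left
      simpa [hf] using p.mem_of_parallel hn hF₁ hF₂ hW ((h.ends_mem_iff _).1 (hF₁ f hf)).2 hs hrest
    · right
      simpa [hf] using p.mem_of_parallel hn hF₂ hF₁ (fun v h₂ h₁ => hW v h₁ h₂)
        ((h.ends_mem_iff _).1 (hF₂ f hf)).2 hs fun g hg => (hrest g hg).symm

theorem paths_nonempty {s t : V} {A : Finset E} (hA : A ∈ G.paths k s t) (hst : s ≠ t) :
    A.Nonempty := by
  obtain ⟨vs, es, p, hn, hes⟩ := hA
  cases p with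
  | nil => exact absurd rfl hst
  | @cons _ v _ f vs es h p => exact ⟨f, (hes f).2 (by simp)⟩

theorem IsExtPar.basic {s t : V} {W : Set V} {F : Set E} (h : G.IsExtPar k s t W F) :
    s ≠ t ∧ s ∈ W ∧ t ∈ W ∧ ∀ e ∈ F, G.src e ∈ W ∧ G.tgt e ∈ W := by
  induction h with
  | @single s t e h hst =>
    refine ⟨hst, by simp, by simp, ?_⟩
    rintro _ rfl
    exact (h.ends_mem_iff _).2 (by simp)
  | @edgeSeries s m t e W F h hs p ih =>
    obtain ⟨-, hm, ht, hF⟩ := ih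
    refine ⟨fun h' => hs (h' ▸ ht), by simp, by simp [ht], ?_⟩
    rintro f (rfl | hf)
    · exact (h.ends_mem_iff _).2 (by simp [hm])
    · exact ⟨Or.inr (hF f hf).1, Or.inr (hF f hf).2⟩
  | @seriesEdge s m t e W F h ht p ih =>
    obtain ⟨-, hs, hm, hF⟩ := ih
    refine ⟨fun h' => ht (h' ▸ hs), by simp [hs], by simp, ?_⟩
    rintro f (rfl | hf)
    · exact (h.ends_mem_iff _).2 (by simp [hm])
    · exact ⟨Or.inr (hF f hf).1, Or.inr (hF f hf).2⟩
  | parallel hW hF p q ih₁ ih₂ =>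
    obtain ⟨hst, hs, ht, h₁⟩ := ih₁
    refine ⟨hst, Or.inl hs, Or.inl ht, ?_⟩
    rintro f (hf | hf)
    · exact ⟨Or.inl (h₁ f hf).1, Or.inl (h₁ f hf).2⟩
    · exact ⟨Or.inr (ih₂.2.2.2 f hf).1, Or.inr (ih₂.2.2.2 f hf).2⟩

/-- The paths between the terminals of an extension-parallel graph. -/
theorem IsExtPar.extParFamily [DecidableEq E] {s t : V} {W : Set V} {F : Set E}
    (h : G.IsExtPar k s t W F) :
    ∃ F' : Finset E, (F' : Set E) = F ∧
      ExtParFamily F' {A | A ∈ G.paths k s t ∧ A ⊆ F'} := by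
  induction h with
  | @single s t e h hst =>
    refine ⟨{e}, by simp, ?_⟩
    convert ExtParFamily.single e
    ext A
    refine ⟨fun ⟨h1, h2⟩ => ?_, ?_⟩
    · exact (Finset.subset_singleton_iff.1 h2).resolve_left (paths_nonempty h1 hst).ne_empty
    · rintro rfl
      exact ⟨⟨_, _, .cons h (.nil t), by simpa using hst, by simp⟩, subset_rfl⟩
  | @edgeSeries s m t e W F h hs hG ih =>
    obtain ⟨F', rfl, hfam⟩ := ih
    obtain ⟨-, hm, ht, hF⟩ := hG.basic
    have hst : s ≠ t := fun h' => hs (h' ▸ ht)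
    have heF : e ∉ F' := fun he => hs ((h.ends_mem_iff W).1 (hF e he)).1
    refine ⟨insert e F', by simp, ?_⟩
    convert ExtParFamily.series heF hfam
    ext A
    constructor
    · rintro ⟨⟨vs, es, p, hn, hes⟩, hA⟩
      cases p with
      | nil => exact absurd rfl hst
      | @cons _ v _ f vs es h' p =>
        obtain ⟨hsvs, hn⟩ := List.nodup_cons.1 hn
        have hmem : ∀ g, g = f ∨ g ∈ es → g = e ∨ g ∈ F' := fun g hg => by
          simpa using hA ((hes g).2 (by simpa using hg))
        obtain rfl : f = e := (hmem f (Or.inl rfl)).resolve_right fun hf =>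
          hs ((h'.ends_mem_iff W).1 (hF f hf)).1
        obtain rfl := h'.right_unique h
        -- The walk leaves `s` through `f` and does not return to `s`.
        have hfes : f ∉ es := fun hf =>
          hsvs ((h.ends_mem_iff {v | v ∈ vs}).1 (p.ends_mem f hf)).1
        refine ⟨es.toFinset, ⟨⟨vs, es, p, hn, by simp⟩, fun g hg => ?_⟩, ?_⟩
        · rw [List.mem_toFinset] at hg
          exact (hmem g (Or.inr hg)).resolve_left fun h => hfes (h ▸ hg)
        · ext g; simp [hes]
    · rintro ⟨B, ⟨⟨vs, es, p, hn, hes⟩, hB⟩, rfl⟩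
      refine ⟨⟨_, _, .cons h p, List.nodup_cons.2 ⟨fun h' => hs ?_, hn⟩, by simp [hes]⟩,
        Finset.insert_subset_insert _ hB⟩
      exact p.mem_of_ends_mem hm (fun f hf => hF f (hB ((hes f).2 hf))) s h'
  | @seriesEdge s m t e W F h ht hG ih =>
    obtain ⟨F', rfl, hfam⟩ := ih
    obtain ⟨-, hs, hm, hF⟩ := hG.basic
    have heF : e ∉ F' := fun he => ht ((h.ends_mem_iff W).1 (hF e he)).2
    refine ⟨insert e F', by simp, ?_⟩
    convert ExtParFamily.series heF hfam
    ext A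
    constructor
    · rintro ⟨⟨vs, es, p, hn, hes⟩, hA⟩
      obtain ⟨vs', es', h1, rfl, rfl, h4⟩ := p.exists_concat hn hF h hs ht fun f hf => by
        simpa using hA ((hes f).2 hf)
      refine ⟨es'.toFinset, ⟨⟨vs', es', h1, (List.nodup_append.1 hn).1, by simp⟩, fun f hf => ?_⟩,
        ?_⟩
      · exact h4 f (by simpa using hf)
      · ext g; simp [hes, or_comm]
    · rintro ⟨B, ⟨⟨vs, es, p, hn, hes⟩, hB⟩, rfl⟩
      refine ⟨⟨_, _, p.concat h, ?_, by simp [hes, or_comm]⟩, Finset.insert_subset_insert _ hB⟩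
      rw [← List.concat_eq_append, List.nodup_concat]
      exact ⟨fun h' => ht (p.mem_of_ends_mem hs (fun f hf => hF f (hB ((hes f).2 hf))) t h'), hn⟩
  | @parallel s t W₁ W₂ F₁ F₂ hW hF p q ih₁ ih₂ =>
    obtain ⟨F₁', rfl, hfam₁⟩ := ih₁
    obtain ⟨F₂', rfl, hfam₂⟩ := ih₂
    obtain ⟨hst, -, -, hF₁⟩ := p.basic
    obtain ⟨-, -, -, hF₂⟩ := q.basic
    refine ⟨F₁' ∪ F₂', by simp, ?_⟩
    convert ExtParFamily.union (Finset.disjoint_coe.1 hF) hfam₁ hfam₂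
    ext A
    constructor
    · rintro ⟨hA, hAF⟩
      have hW' : ∀ v ∈ W₁, v ∈ W₂ → v = s ∨ v = t := fun v h₁ h₂ => by
        have : v ∈ W₁ ∩ W₂ := ⟨h₁, h₂⟩
        simpa [hW] using this
      exact (paths_parallel hA hst hF₁ hF₂ hW' fun f hf => by simpa using hAF hf).imp
        (fun h => ⟨hA, h⟩) fun h => ⟨hA, h⟩
    · rintro (⟨hA, h⟩ | ⟨hA, h⟩)
      · exact ⟨hA, h.trans Finset.subset_union_left⟩
      · exact ⟨hA, h.trans Finset.subset_union_right⟩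

end EdgeGraph

namespace AffineCongestionGame

variable {Γ : AffineCongestionGame.{u}}

theorem IsNash.sum_sdiff_le (hlin : Γ.IsLinear) {ρ : ℝ} {s : Γ.Profile} (hs : Γ.IsNash ρ s)
    (i : Fin Γ.n) {r : Finset Γ.Res} (hr : r ∈ Γ.strat i) :
    ∑ e ∈ (s i : Finset Γ.Res) \ r, Γ.a e * (1 + ρ * ((Γ.load s e : ℝ) - 1)) ≤
      ∑ e ∈ r \ (s i : Finset Γ.Res), Γ.a e * (1 + ρ * (Γ.load s e : ℝ)) := by
  have h := hs i ⟨r, hr⟩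
  rw [playerCost_update hlin, playerCost_eq hlin,
    ← Finset.sum_inter_add_sum_sdiff (s i : Finset Γ.Res) r,
    ← Finset.sum_inter_add_sum_sdiff r (s i : Finset Γ.Res), Finset.inter_comm,
    add_le_add_iff_left] at h
  refine (Finset.sum_congr rfl fun e he => ?_).trans_le
    (h.trans_eq (Finset.sum_congr rfl fun e he => ?_))
  · rw [load_eq_restLoad s i, if_pos (Finset.mem_sdiff.1 he).1]; push_cast; ring
  · rw [load_eq_restLoad s i, if_neg (Finset.mem_sdiff.1 he).2]; simp

theorem PoA_le_of_isOnExtPar {ρ : ℝ} (hρ : 0 ≤ ρ) {k : EdgeKind} (hlin : Γ.IsLinear)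
    (hext : Γ.IsOnExtPar k) : Γ.PoA ρ 1 ≤ perceptionBound ρ := by
  rcases hρ.eq_or_lt with rfl | hρ'
  · simp [perceptionBound_zero]
  obtain ⟨β, c, hβ, hc, hB, hsm⟩ := exists_smoothness hρ'
  rw [hB]
  refine PoA_le_of_forall hβ fun s hs y => ?_
  obtain ⟨V, _, G, st, tt, hG, hst⟩ := hext
  obtain ⟨F, hF, hfam⟩ := hG.extParFamily
  obtain rfl : F = Finset.univ := by simpa using hF
  have huses : ∀ s : Γ.Profile, ExtParFamily.Uses Finset.univ
      {A | A ∈ G.paths k st tt ∧ A ⊆ Finset.univ} (fun i => (s i : Finset Γ.Res))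
      Finset.univ := fun s =>
    ⟨fun i _ => ⟨by rw [Finset.inter_univ, ← hst i]; exact (s i).2, Finset.subset_univ _⟩, by simp⟩
  have hvar := hfam.le_sum_stepCost (cp := fun e => Γ.a e * (1 + ρ * (Γ.load s e : ℝ)))
    (cm := fun e => Γ.a e * (1 + ρ * ((Γ.load s e : ℝ) - 1))) Finset.univ Finset.univ
    (huses s) (huses y)
    (fun i _ r hr => by
      rw [Finset.inter_univ]
      exact hs.sum_sdiff_le hlin i (by rw [hst i]; exact hr.1)) 0 (by simp) (by simp)
  rw [mul_zero] at hvar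
  have h := sum_sq_le_of_deviationCost hc hsm Γ.a_nonneg (x := fun e => (Γ.load s e : ℤ))
    (y := fun e => (Γ.load y e : ℤ)) (fun e => by positivity) (fun e => by positivity) (by
      refine hvar.trans_eq (Finset.sum_congr rfl fun e _ => ?_)
      simp only [deviationCost, EdgeGraph.stepCost, load, Int.cast_natCast]
      split_ifs <;> ring)
  rw [socialCost_eq hlin, socialCost_eq hlin]
  simpa using h

end AffineCongestionGame

/-! ### Parallel links -/

namespace AffineCongestionGame

theorem IsOnExtPar.isNetwork {Γ : AffineCongestionGame.{u}} {k : EdgeKind} (h : Γ.IsOnExtPar k) :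
    Γ.IsNetwork k := by
  obtain ⟨V, hV, G, s, t, -, hst⟩ := h
  exact ⟨V, hV, G, fun _ => s, fun _ => t, hst⟩

theorem IsOnExtPar.isSymmetric {Γ : AffineCongestionGame.{u}} {k : EdgeKind}
    (h : Γ.IsOnExtPar k) : Γ.IsSymmetric := by
  obtain ⟨V, hV, G, s, t, -, hst⟩ := h
  exact fun i j => by rw [hst, hst]

/-- The game of `n` players on `n + 1` parallel links, of which the link `none` has slope `1` and
all the others have slope `A`. -/
abbrev linkGame (n : ℕ) (A : ℝ) (hA : 0 ≤ A) : AffineCongestionGame.{u} where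
  n := n
  Res := ULift.{u} (Option (Fin n))
  strat _ := {F | ∃ e, F = {e}}
  a e := e.down.elim 1 fun _ => A
  b _ := 0
  a_nonneg e := by rcases e with ⟨_ | j⟩ <;> simp [hA]
  b_nonneg _ := le_rfl

variable {n : ℕ} {A : ℝ} {hA : 0 ≤ A}

theorem linkGame_isLinear : (linkGame.{u} n A hA).IsLinear := fun _ => rfl

theorem linkGame_isOnExtPar (k : EdgeKind) : (linkGame.{u} n A hA).IsOnExtPar k := by
  let G : EdgeGraph (ULift.{u} Bool) (linkGame.{u} n A hA).Res :=
    ⟨fun _ => ⟨false⟩, fun _ => ⟨true⟩⟩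
  have hj : ∀ e, G.Joins k e ⟨false⟩ ⟨true⟩ := fun e => by
    cases k
    · exact ⟨rfl, rfl⟩
    · exact Or.inl ⟨rfl, rfl⟩
  have hne : (⟨false⟩ : ULift.{u} Bool) ≠ ⟨true⟩ := by simp
  have hW : ({⟨false⟩, ⟨true⟩} : Set (ULift.{u} Bool)) = Set.univ := by
    ext ⟨b⟩; cases b <;> simp
  have hF : ∀ F : Finset (linkGame.{u} n A hA).Res, F.Nonempty →
      G.IsExtPar k ⟨false⟩ ⟨true⟩ {⟨false⟩, ⟨true⟩} (F : Set _) := by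
    intro F hF
    induction hF using Finset.Nonempty.cons_induction with
    | singleton e => simpa using EdgeGraph.IsExtPar.single (hj e) hne
    | cons e F he _ ih =>
      have := EdgeGraph.IsExtPar.parallel (Set.inter_self _)
        (Set.disjoint_singleton_left.2 (by simpa using he))
        (EdgeGraph.IsExtPar.single (hj e) hne) ih
      rwa [Set.union_self, ← Set.insert_eq, ← Finset.coe_insert, ← Finset.cons_eq_insert e F he]
        at this
  refine ⟨ULift.{u} Bool, inferInstance, G, ⟨false⟩, ⟨true⟩, ?_, fun i => ?_⟩
  · have := hF Finset.univ ⟨⟨none⟩, Finset.mem_univ _⟩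
    rwa [hW, Finset.coe_univ] at this
  · ext F
    constructor
    · rintro ⟨e, rfl⟩
      exact ⟨_, _, .cons (hj e) (.nil _), by simp, by simp⟩
    · rintro ⟨vs, es, p, hn, hes⟩
      cases p with
      | @cons _ v _ e vs es h p =>
        obtain rfl := h.right_unique (hj e)
        obtain ⟨rfl, rfl⟩ := p.eq_nil (List.nodup_cons.1 hn).2
        exact ⟨e, by ext f; simp [hes]⟩

/-- The profile in which player `i` uses the link `c i`. -/
def linkProfile (c : Fin n → Option (Fin n)) : (linkGame.{u} n A hA).Profile :=
  fun i => ⟨{⟨c i⟩}, ⟨c i⟩, rfl⟩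

theorem exists_eq_linkProfile (s : (linkGame.{u} n A hA).Profile) :
    ∃ c : Fin n → Option (Fin n), s = linkProfile c := by
  choose c hc using fun i => (s i).2
  exact ⟨fun i => (c i).down, funext fun i => Subtype.ext (hc i)⟩

theorem load_linkProfile (c : Fin n → Option (Fin n)) (e : Option (Fin n)) :
    (linkGame.{u} n A hA).load (linkProfile c) ⟨e⟩ =
      (Finset.univ.filter fun i => c i = e).card := by
  unfold load
  congr 1
  ext i
  simp only [Finset.mem_filter]
  refine and_congr Iff.rfl (Finset.mem_singleton.trans ?_)
  exact ⟨fun h => (congrArg ULift.down h).symm, fun h => congrArg ULift.up h.symm⟩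

theorem restLoad_linkProfile (c : Fin n → Option (Fin n)) (i : Fin n) (e : Option (Fin n)) :
    restLoad (Γ := linkGame.{u} n A hA) (linkProfile c) i ⟨e⟩ =
      (Finset.univ.filter fun j => j ≠ i ∧ c j = e).card := by
  unfold restLoad
  congr 1
  ext j
  simp only [Finset.mem_filter]
  refine and_congr Iff.rfl (and_congr Iff.rfl (Finset.mem_singleton.trans ?_))
  exact ⟨fun h => (congrArg ULift.down h).symm, fun h => congrArg ULift.up h.symm⟩

theorem socialCost_linkProfile (c : Fin n → Option (Fin n)) :
    (linkGame.{u} n A hA).socialCost 1 (linkProfile c) =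
      ((Finset.univ.filter fun i => c i = none).card : ℝ) ^ 2 +
        ∑ j, A * ((Finset.univ.filter fun i => c i = some j).card : ℝ) ^ 2 := by
  rw [socialCost_eq linkGame_isLinear]
  refine (Fintype.sum_equiv Equiv.ulift _ (fun e : Option (Fin n) => (e.elim 1 fun _ => A) *
    ((Finset.univ.filter fun i => c i = e).card : ℝ) ^ 2) fun e => ?_).trans ?_
  · rw [← load_linkProfile.{u} (A := A) (hA := hA)]; rfl
  · rw [Fintype.sum_option]; simp

theorem IsNash.linkProfile_le {ρ : ℝ} {c : Fin n → Option (Fin n)}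
    (h : (linkGame.{u} n A hA).IsNash ρ (linkProfile c)) (i : Fin n) (e : Option (Fin n)) :
    ((c i).elim 1 fun _ => A) *
        (1 + ρ * ((Finset.univ.filter fun j => j ≠ i ∧ c j = c i).card : ℝ)) ≤
      (e.elim 1 fun _ => A) *
        (1 + ρ * ((Finset.univ.filter fun j => j ≠ i ∧ c j = e).card : ℝ)) := by
  have := h i ⟨{⟨e⟩}, ⟨e⟩, rfl⟩
  rw [playerCost_update linkGame_isLinear, playerCost_eq linkGame_isLinear] at this
  have h2 : ((linkProfile (A := A) (hA := hA) c i : Finset (linkGame.{u} n A hA).Res)) =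
    {⟨c i⟩} := rfl
  rw [h2, Finset.sum_singleton, Finset.sum_singleton, restLoad_linkProfile,
    restLoad_linkProfile] at this
  exact this

/-- The assignment of the first `k` players to the common link and of every other player to a link
of its own. -/
def splitAssignment (n k : ℕ) (i : Fin n) : Option (Fin n) := if (i : ℕ) < k then none else some i

theorem socialCost_splitAssignment {k : ℕ} (hk : k ≤ n) :
    (linkGame.{u} n A hA).socialCost 1 (linkProfile (splitAssignment n k)) =
      (k : ℝ) ^ 2 + (n - k) * A := by
  have hcard : (Finset.univ.filter fun i : Fin n => (i : ℕ) < k).card = k := by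
    rw [Fin.card_filter_val_lt, min_eq_right hk]
  have hnone : (Finset.univ.filter fun i => splitAssignment n k i = none).card = k := by
    refine (congrArg Finset.card ?_).trans hcard
    ext i
    simp [splitAssignment]
  have hsome : ∀ j : Fin n, (Finset.univ.filter fun i => splitAssignment n k i = some j).card =
      if (j : ℕ) < k then 0 else 1 := by
    intro j
    split_ifs with hj
    · rw [Finset.card_eq_zero, Finset.filter_eq_empty_iff]
      intro i _
      simp only [splitAssignment]
      split_ifs with hi
      · simp
      · simp only [Option.some.injEq]
        rintro rfl
        exact hi hj
    · rw [Finset.card_eq_one]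
      refine ⟨j, ?_⟩
      ext i
      rw [Finset.mem_filter, Finset.mem_singleton]
      simp only [splitAssignment, Finset.mem_univ, true_and]
      split_ifs with hi
      · simp only [false_iff]
        rintro rfl
        exact hj hi
      · simp
  rw [socialCost_linkProfile, hnone]
  simp only [hsome]
  congr 1
  have hcompl : ((Finset.univ.filter fun i : Fin n => ¬ (i : ℕ) < k).card : ℝ) = n - k := by
    have := Finset.card_filter_add_card_filter_not (s := (Finset.univ : Finset (Fin n)))
      fun i : Fin n => (i : ℕ) < k
    rw [hcard, Finset.card_univ, Fintype.card_fin] at this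
    rw [eq_sub_iff_add_eq, add_comm]
    exact_mod_cast this
  rw [← hcompl, Finset.card_filter]
  push_cast
  rw [Finset.sum_mul]
  exact Finset.sum_congr rfl fun j _ => by split_ifs <;> simp

/-- If the other links are too slow even for a single player, then all players share the link
`none` in equilibrium. -/
theorem le_socialCost_of_isNash_of_lt {ρ : ℝ} (hρ : 0 ≤ ρ) (hlt : 1 + ρ * (n - 1) < A)
    {s : (linkGame.{u} n A hA).Profile} (hs : (linkGame.{u} n A hA).IsNash ρ s) :
    (n : ℝ) ^ 2 ≤ (linkGame.{u} n A hA).socialCost 1 s := by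
  obtain ⟨c, rfl⟩ := exists_eq_linkProfile s
  have hc : ∀ i, c i = none := by
    intro i
    by_contra hi
    obtain ⟨j, hj⟩ := Option.ne_none_iff_exists'.1 hi
    have h := hs.linkProfile_le i none
    rw [hj] at h
    simp only [Option.elim] at h
    have hcard : ((Finset.univ.filter fun j => j ≠ i ∧ c j = none).card : ℝ) ≤ n - 1 := by
      have h1 : (Finset.univ.filter fun j => j ≠ i ∧ c j = none).card + 1 ≤ n := by
        have h2 : (Finset.univ.filter fun j => j ≠ i ∧ c j = none) ⊆ Finset.univ.erase i :=
          fun j hj => by simpa using (Finset.mem_filter.1 hj).2.1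
        have h3 := Finset.card_le_card h2
        rw [Finset.card_erase_of_mem (Finset.mem_univ i), Finset.card_univ,
          Fintype.card_fin] at h3
        have := i.pos
        omega
      rw [le_sub_iff_add_le]
      exact_mod_cast h1
    have h4 : 0 ≤ A * (ρ * ((Finset.univ.filter fun j' => j' ≠ i ∧ c j' = some j).card : ℝ)) := by
      positivity
    have h5 := mul_le_mul_of_nonneg_left hcard hρ
    linarith
  rw [socialCost_linkProfile]
  simp [hc]

/-- If the other links are faster than the link `none` with two users but slower than an unused
one, then exactly one of two players uses the link `none` in equilibrium. -/
theorem le_socialCost_of_isNash_two {ρ : ℝ} (hρ : 0 ≤ ρ) (h1 : 1 < A) (h2 : A < 1 + ρ)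
    {s : (linkGame.{u} 2 A hA).Profile} (hs : (linkGame.{u} 2 A hA).IsNash ρ s) :
    1 + A ≤ (linkGame.{u} 2 A hA).socialCost 1 s := by
  obtain ⟨c, rfl⟩ := exists_eq_linkProfile s
  have hsum : ((c 0).elim 1 fun _ => A) + ((c 1).elim 1 fun _ => A) ≤
      (linkGame.{u} 2 A hA).socialCost 1 (linkProfile c) := by
    have hle : ∀ i : Fin 2, ((c i).elim 1 fun _ => A) ≤
        (linkGame.{u} 2 A hA).playerCost 1 (linkProfile c) i := fun i => by
      rw [playerCost_eq linkGame_isLinear]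
      have h3 : ((linkProfile (A := A) (hA := hA) c i : Finset (linkGame.{u} 2 A hA).Res)) =
        {⟨c i⟩} := rfl
      rw [h3, Finset.sum_singleton]
      refine le_mul_of_one_le_right ?_ (by simp)
      cases c i <;> simp [hA]
    refine (add_le_add (hle 0) (hle 1)).trans_eq ?_
    exact (Fin.sum_univ_two _).symm
  have h01 := hs.linkProfile_le 0 none
  have h02 := hs.linkProfile_le 0 (some 0)
  rcases h0 : c 0 with _ | i <;> rcases h1' : c 1 with _ | j
  · simp only [Finset.card_filter, Fin.sum_univ_two, h0, h1'] at h02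
    simp at h02
    linarith
  · simpa [h0, h1'] using hsum
  · simpa [h0, h1', add_comm] using hsum
  · have h3 : 0 ≤ A * (ρ * ((Finset.univ.filter fun j => j ≠ 0 ∧ c j = c 0).card : ℝ)) := by
      positivity
    rw [h0] at h01 h3
    simp only [Finset.card_filter, Fin.sum_univ_two, h0, h1'] at h01 h3
    simp at h01 h3
    split_ifs at h01 h3 <;> linarith

theorem ofReal_div_le_PoS {ρ N : ℝ} {k : ℕ} (hk : k ≤ n)
    (hD : 0 < (k : ℝ) ^ 2 + (n - k) * A)
    (hN : ∀ s, (linkGame.{u} n A hA).IsNash ρ s → N ≤ (linkGame.{u} n A hA).socialCost 1 s) :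
    ENNReal.ofReal (N / ((k : ℝ) ^ 2 + (n - k) * A)) ≤ (linkGame.{u} n A hA).PoS ρ 1 := by
  rw [ENNReal.ofReal_div_of_pos hD]
  refine ENNReal.div_le_div (le_iInf₂ fun s hs => ENNReal.ofReal_le_ofReal (hN s hs)) ?_
  rw [← socialCost_splitAssignment.{u} (hA := hA) hk]
  exact iInf_le _ _

open Filter Topology in
/-- Parallel links attain the bound in the limit: `n` players with all other links just too slow,
for `n → ∞` if `ρ ≤ 1` and for `n = 2` if `1 ≤ ρ ≤ 2`, and two players with the other links just
fast enough if `ρ ≥ 2`. -/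
theorem perceptionBound_le_of_linkGame {ρ : ℝ} (hρ : 0 ≤ ρ) {X : ℝ≥0∞}
    (hX : ∀ n A hA, (linkGame.{u} n A hA).PoS ρ 1 ≤ X) : perceptionBound ρ ≤ X := by
  rcases le_or_gt ρ 1 with h1 | h1
  · -- An optimal profile leaves about `ρ n / 2` players on the link `none`.
    have hlow : ∀ n : ℕ, 0 < n → ENNReal.ofReal
        (1 / (((⌊ρ / 2 * n⌋₊ : ℝ) / n) ^ 2 + (1 - (⌊ρ / 2 * n⌋₊ : ℝ) / n) * (2 / n + ρ))) ≤ X := by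
      intro n hn
      have hn' : (0 : ℝ) < n := by exact_mod_cast hn
      have hkr : (⌊ρ / 2 * n⌋₊ : ℝ) ≤ ρ / 2 * n := Nat.floor_le (by positivity)
      have hk' : (⌊ρ / 2 * n⌋₊ : ℝ) < n := by nlinarith
      have hk : ⌊ρ / 2 * n⌋₊ ≤ n := by exact_mod_cast hk'.le
      have hA : 0 ≤ 2 + ρ * n := by positivity
      have hD : 0 < (⌊ρ / 2 * n⌋₊ : ℝ) ^ 2 + (n - ⌊ρ / 2 * n⌋₊) * (2 + ρ * n) := by
        have := mul_pos (sub_pos.2 hk') (show 0 < 2 + ρ * n by positivity)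
        positivity
      refine le_trans (le_of_eq ?_) ((ofReal_div_le_PoS.{u} (hA := hA) hk hD fun s hs =>
        le_socialCost_of_isNash_of_lt hρ (by linarith) hs).trans (hX n _ hA))
      congr 1
      generalize (⌊ρ / 2 * n⌋₊ : ℝ) = κ at *
      have : (κ / n) ^ 2 + (1 - κ / n) * (2 / n + ρ) =
          (κ ^ 2 + (n - κ) * (2 + ρ * n)) / n ^ 2 := by
        field_simp
      rw [this, one_div_div]
    have hden : Tendsto (fun n : ℕ => ((⌊ρ / 2 * n⌋₊ : ℝ) / n) ^ 2 +
        (1 - (⌊ρ / 2 * n⌋₊ : ℝ) / n) * (2 / n + ρ)) atTop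
        (𝓝 ((ρ / 2) ^ 2 + (1 - ρ / 2) * (0 + ρ))) := by
      have hfl : Tendsto (fun n : ℕ => (⌊ρ / 2 * n⌋₊ : ℝ) / n) atTop (𝓝 (ρ / 2)) :=
        (tendsto_nat_floor_mul_div_atTop (by positivity)).comp tendsto_natCast_atTop_atTop
      exact (hfl.pow 2).add ((tendsto_const_nhds.sub hfl).mul
        ((tendsto_const_div_atTop_nhds_zero_nat 2).add tendsto_const_nhds))
    rcases hρ.eq_or_lt with rfl | hρ'
    · refine le_of_tendsto (ENNReal.tendsto_ofReal_atTop.comp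
        (tendsto_natCast_atTop_atTop.atTop_div_const (show (0 : ℝ) < 2 by norm_num)))
        (b := X) ?_ |> le_trans le_top
      filter_upwards [eventually_gt_atTop 0] with n hn
      refine le_trans (le_of_eq ?_) (hlow n hn)
      rw [Function.comp_apply]
      congr 1
      simp
    · have hpos : 0 < ρ * (4 - ρ) := mul_pos hρ' (by linarith)
      have hlim := (tendsto_const_nhds (x := (1 : ℝ))).div hden (by nlinarith)
      have hval : 1 / ((ρ / 2) ^ 2 + (1 - ρ / 2) * (0 + ρ)) = 4 / (ρ * (4 - ρ)) := by
        rw [div_eq_div_iff (by nlinarith) hpos.ne']; ring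
      rw [hval] at hlim
      rw [perceptionBound, if_pos h1, ← ENNReal.ofReal_div_of_pos hpos]
      refine le_of_tendsto (ENNReal.tendsto_ofReal hlim) ?_
      filter_upwards [eventually_gt_atTop 0] with n hn
      exact hlow n hn
  rcases le_or_gt ρ 2 with h2 | h2
  · rw [perceptionBound, if_neg h1.not_ge, if_pos h2]
    have hlim : Tendsto (fun ε : ℝ => 4 / (2 + ρ + ε)) (𝓝[>] 0) (𝓝 (4 / (2 + ρ))) := by
      have h : Tendsto (fun ε : ℝ => 2 + ρ + ε) (𝓝[>] 0) (𝓝 (2 + ρ + 0)) :=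
        tendsto_const_nhds.add (tendsto_id.mono_left nhdsWithin_le_nhds)
      rw [add_zero] at h
      exact tendsto_const_nhds.div h (by linarith)
    refine le_of_tendsto (ENNReal.tendsto_ofReal hlim) ?_
    filter_upwards [self_mem_nhdsWithin] with ε hε
    have hε' : 0 < ε := hε
    have hA : 0 ≤ 1 + ρ + ε := by positivity
    refine le_trans (le_of_eq ?_) ((ofReal_div_le_PoS.{u} (n := 2) (k := 1) (hA := hA)
      (by norm_num) (by norm_num; linarith) fun s hs =>
        le_socialCost_of_isNash_of_lt hρ (by norm_num; linarith) hs).trans (hX 2 _ hA))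
    congr 1
    norm_num
    ring
  · rw [perceptionBound, if_neg h1.not_ge, if_neg h2.not_ge]
    have hlim : Tendsto (fun ε : ℝ => (2 + ρ - ε) / 4) (𝓝[>] 0) (𝓝 ((2 + ρ) / 4)) := by
      have h : Tendsto (fun ε : ℝ => 2 + ρ - ε) (𝓝[>] 0) (𝓝 (2 + ρ - 0)) :=
        tendsto_const_nhds.sub (tendsto_id.mono_left nhdsWithin_le_nhds)
      rw [sub_zero] at h
      exact h.div_const 4
    refine le_of_tendsto (ENNReal.tendsto_ofReal hlim) ?_
    filter_upwards [Ioo_mem_nhdsGT (show (0 : ℝ) < ρ by linarith)] with ε hε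
    have hA : 0 ≤ 1 + ρ - ε := by linarith [hε.2]
    refine le_trans (le_of_eq ?_) ((ofReal_div_le_PoS.{u} (n := 2) (k := 2) (hA := hA)
      le_rfl (by norm_num) fun s hs =>
        le_socialCost_of_isNash_two hρ (by linarith [hε.2]) (by linarith [hε.1]) hs).trans
          (hX 2 _ hA))
    congr 1
    norm_num
    ring

end AffineCongestionGame

theorem mainTheorem7 (ρ : ℝ) (hρ : 0 ≤ ρ) (k : EdgeKind) :
    (∀ Γ : AffineCongestionGame.{u}, Γ.IsLinear → Γ.IsSymmetric → Γ.IsNetwork k →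
      Γ.PoS ρ 1 ≤ perceptionBound ρ) ∧
    (∀ Γ : AffineCongestionGame.{u}, Γ.IsLinear → Γ.IsOnExtPar k →
      Γ.PoA ρ 1 ≤ perceptionBound ρ) ∧
    AffineCongestionGame.classPoS
      {Γ : AffineCongestionGame.{u} | Γ.IsLinear ∧ Γ.IsSymmetric ∧ Γ.IsNetwork k} ρ 1 =
        perceptionBound ρ ∧
    AffineCongestionGame.classPoA
      {Γ : AffineCongestionGame.{u} | Γ.IsLinear ∧ Γ.IsOnExtPar k} ρ 1 =
        perceptionBound ρ := by
  have h1 := fun (Γ : AffineCongestionGame.{u}) h2 h3 h4 =>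
    AffineCongestionGame.PoS_le_of_isNetwork (Γ := Γ) hρ (k := k) h2 h3 h4
  have h2 := fun (Γ : AffineCongestionGame.{u}) h2 h3 =>
    AffineCongestionGame.PoA_le_of_isOnExtPar (Γ := Γ) hρ (k := k) h2 h3
  refine ⟨h1, h2, le_antisymm (iSup₂_le fun Γ h => h1 Γ h.1 h.2.1 h.2.2) ?_,
    le_antisymm (iSup₂_le fun Γ h => h2 Γ h.1 h.2) ?_⟩
  · refine AffineCongestionGame.perceptionBound_le_of_linkGame.{u} hρ fun n A hA => ?_
    have hE := AffineCongestionGame.linkGame_isOnExtPar.{u} (n := n) (hA := hA) k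
    exact le_iSup₂ (f := fun Γ _ => AffineCongestionGame.PoS Γ ρ 1)
      (AffineCongestionGame.linkGame.{u} n A hA)
      ⟨AffineCongestionGame.linkGame_isLinear, hE.isSymmetric, hE.isNetwork⟩
  · refine AffineCongestionGame.perceptionBound_le_of_linkGame.{u} hρ fun n A hA => ?_
    have hE := AffineCongestionGame.linkGame_isOnExtPar.{u} (n := n) (hA := hA) k
    have : Nonempty (AffineCongestionGame.linkGame.{u} n A hA).Profile :=
      ⟨AffineCongestionGame.linkProfile fun _ => none⟩
    exact (AffineCongestionGame.PoS_le_PoA AffineCongestionGame.linkGame_isLinear ρ 1).trans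
      (le_iSup₂ (f := fun Γ _ => AffineCongestionGame.PoA Γ ρ 1)
        (AffineCongestionGame.linkGame.{u} n A hA) ⟨AffineCongestionGame.linkGame_isLinear, hE⟩)
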